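/- Let $\{S_n\}_{n\ge 0}$ be a simple symmetric random walk on $\mathbb{Z}$ with $S_0=0$, i.e. the increments $S_n-S_{n-1}$, $n\ge 1$, are i.i.d. with $\mathbb{P}(S_1=1)=\mathbb{P}(S_1=-1)=\tfrac12$. For $x\in\mathbb{Z}$ and $n\ge 1$ let $L(x,n):=\#\{0<k\le n: \{S_{k-1},S_k\}=\{x,x+1\}\}$ be the number of times that the walk crosses the edge $\langle x,x+1\rangle$, in either direction, up to time $n$, and let $\alpha(n):=\#\{x\in\mathbb{Z}: L(x,n)=1\}$ be the number of rarely visited edges (edges crossed exactly once) up to time $n$. Then for all $a>0$ and $\varepsilon>0$ there exists $N_0=N_0(a,\varepsilon)$ such that for all integers $n>N_0$, $$ n^{-2a-\varepsilon}<\mathbb{P}\left(\alpha(n)>a(\log n)^2\right)<n^{-2a+\varepsilon}. $$ -/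

import Mathlib

open MeasureTheory ProbabilityTheory

namespace RarelyVisited

/-- `S` is a simple symmetric random walk on `ℤ` started at `0`, on the probability space
`(Ω, P)`: the increments `S (n+1) - S n` are independent and each of them takes the values `1`
and `-1` with probability `1/2` (so they are identically distributed). -/
structure IsSimpleSymmetricRandomWalk {Ω : Type*} [MeasurableSpace Ω]
    (P : Measure Ω) (S : ℕ → Ω → ℤ) : Prop where
  measurable : ∀ n, Measurable (S n)
  start : ∀ᵐ ω ∂P, S 0 ω = 0
  indep : iIndepFun (fun n ω => S (n + 1) ω - S n ω) P
  prob_up : ∀ n, P {ω | S (n + 1) ω - S n ω = 1} = 1 / 2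
  prob_down : ∀ n, P {ω | S (n + 1) ω - S n ω = -1} = 1 / 2

/-- Number of upcrossings of `y` (steps from `y - 1` to `y`) by the path `s` up to time `n`. -/
def upcrossings (s : ℕ → ℤ) (y : ℤ) (n : ℕ) : ℕ :=
  ((Finset.Ioc 0 n).filter (fun k => s k = y ∧ s (k - 1) = y - 1)).card

/-- Number of downcrossings of `y` (steps from `y + 1` to `y`) by the path `s` up to time `n`. -/
def downcrossings (s : ℕ → ℤ) (y : ℤ) (n : ℕ) : ℕ :=
  ((Finset.Ioc 0 n).filter (fun k => s k = y ∧ s (k - 1) = y + 1)).card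

/-- Number of times that the path `s` visits the edge `⟨y, y + 1⟩` up to time `n`. -/
def edgeVisits (s : ℕ → ℤ) (y : ℤ) (n : ℕ) : ℕ :=
  upcrossings s (y + 1) n + downcrossings s y n

/-- The rarely visited edges `⟨x, x + 1⟩` of the path `s` up to time `n`, that is, the edges
visited exactly once; an edge is represented by its left endpoint `x`. -/
def rareEdges (s : ℕ → ℤ) (n : ℕ) : Set ℤ :=
  {x | edgeVisits s x n = 1}

/-- There are only finitely many rarely visited edges, so that `Set.ncard` counts them. -/
theorem rareEdges_finite (s : ℕ → ℤ) (n : ℕ) : (rareEdges s n).Finite := by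
  refine ((((Finset.Ioc 0 n).image s) ∪ ((Finset.Ioc 0 n).image (fun k => s k - 1))
    ).finite_toSet).subset ?_
  intro x hx
  have hx' : upcrossings s (x + 1) n + downcrossings s x n = 1 := hx
  have h : 0 < upcrossings s (x + 1) n ∨ 0 < downcrossings s x n := by omega
  rcases h with h | h
  · obtain ⟨k, hk⟩ := Finset.card_pos.mp h
    obtain ⟨hk1, hk2, -⟩ := Finset.mem_filter.mp hk
    exact Finset.mem_coe.mpr (Finset.mem_union_right _
      (Finset.mem_image.mpr ⟨k, hk1, by simp [hk2]⟩))
  · obtain ⟨k, hk⟩ := Finset.card_pos.mp h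
    obtain ⟨hk1, hk2, -⟩ := Finset.mem_filter.mp hk
    exact Finset.mem_coe.mpr (Finset.mem_union_left _
      (Finset.mem_image.mpr ⟨k, hk1, hk2⟩))

/-- The number `α(n)` of rarely visited edges of the path `s` up to time `n`. -/
noncomputable def alpha (s : ℕ → ℤ) (n : ℕ) : ℕ :=
  (rareEdges s n).ncard

end RarelyVisited

/-! An edge crossed exactly once separates the past of the walk from its future, so the rarely
visited edges are the cut steps of the path. An upward cut forces a positive endpoint and a downward
cut a negative one, so the two kinds never coexist, and by reflection the tail of `alpha` is twice
the tail of the number of upward cuts (`alpha_eq`, `pr_map_not_or_numCuts`).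

Splitting a path at its upward cuts gives blocks: irreducible bridges, each with one up step, with
generating function F = `irrSeries`. By unique factorization the probability of at least i + 1 cuts
in length m + 1 is the coefficient of X^m in F^i (1 - F) C (`pr_numCuts_ge_eq`), where C =
`cutSeries` has all coefficients in [1/2, 1]. Writing f_n = `psum n irrSeries` for the weight of
blocks of length at most n, the tail is at most f_n^i (`pr_numCuts_ge_le`). Conversely, up to a
factor of order log n, it is at least f_j^i for any j with i j < n (`le_mul_pr_numCuts_ge`,
`pow_psum_le`).

The size of f_n comes from the renewal series 1 / (1 - F) = `bridgeSeries`, which counts all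
bridges. By gambler's ruin the bridges of height k have total probability 2 / (k + 2), and within n
steps only heights up to about √n matter. Hence the partial sums of the renewal series are about
(1/2) · 2 log √n = (log n) / 2, and 1 - f_n is about 2 / log n. For i = a (log n)^2 this gives (1 -
2 / log n)^i = n^(-2a + o(1)). In the lower bound j = n^c with c < 1 close to 1 costs only an
arbitrarily small change of the exponent. -/

namespace RarelyVisited

/-! ### Words in two letters and uniform averages. -/

/-- The increment coded by a letter: `true` is a step up, `false` a step down. -/
def letterStep (b : Bool) : ℤ := if b then 1 else -1

/-- Total increment of a word. -/
def ht (w : List Bool) : ℤ := (w.map letterStep).sum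

@[simp] theorem letterStep_true : letterStep true = 1 := rfl

@[simp] theorem letterStep_false : letterStep false = -1 := rfl

@[simp] theorem ht_nil : ht [] = 0 := rfl

@[simp] theorem ht_cons (b : Bool) (w : List Bool) : ht (b :: w) = letterStep b + ht w := by
  simp [ht]

@[simp] theorem ht_append (u v : List Bool) : ht (u ++ v) = ht u + ht v := by
  simp [ht]

/-- Average of `f` over all words of length `n`. -/
noncomputable def avg : ℕ → (List Bool → ℝ) → ℝ
  | 0, f => f []
  | n + 1, f => (avg n (fun w => f (true :: w)) + avg n (fun w => f (false :: w))) / 2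

theorem avg_congr {n : ℕ} {f g : List Bool → ℝ} (h : ∀ w, w.length = n → f w = g w) :
    avg n f = avg n g := by
  induction n generalizing f g with
  | zero => exact h [] rfl
  | succ n ih =>
    simp only [avg]
    rw [ih (fun w hw => h (true :: w) (by simp [hw])),
      ih (fun w hw => h (false :: w) (by simp [hw]))]

theorem avg_mono {n : ℕ} {f g : List Bool → ℝ} (h : ∀ w, w.length = n → f w ≤ g w) :
    avg n f ≤ avg n g := by
  induction n generalizing f g with
  | zero => exact h [] rfl
  | succ n ih =>
    simp only [avg]
    have h1 := ih (fun w hw => h (true :: w) (by simp [hw]))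
    have h2 := ih (fun w hw => h (false :: w) (by simp [hw]))
    linarith

@[simp] theorem avg_const (n : ℕ) (c : ℝ) : avg n (fun _ => c) = c := by
  induction n with
  | zero => rfl
  | succ n ih => simp [avg, ih]

theorem avg_add (n : ℕ) (f g : List Bool → ℝ) :
    avg n (fun w => f w + g w) = avg n f + avg n g := by
  induction n generalizing f g with
  | zero => rfl
  | succ n ih => simp only [avg, ih]; ring

theorem avg_mul_left (n : ℕ) (c : ℝ) (f : List Bool → ℝ) :
    avg n (fun w => c * f w) = c * avg n f := by
  induction n generalizing f with
  | zero => rfl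
  | succ n ih => simp only [avg, ih]; ring

theorem avg_sub (n : ℕ) (f g : List Bool → ℝ) :
    avg n (fun w => f w - g w) = avg n f - avg n g := by
  induction n generalizing f g with
  | zero => rfl
  | succ n ih => simp only [avg, ih]; ring

theorem avg_sum {ι : Type*} (n : ℕ) (s : Finset ι) (f : ι → List Bool → ℝ) :
    avg n (fun w => ∑ i ∈ s, f i w) = ∑ i ∈ s, avg n (f i) := by
  induction n generalizing f with
  | zero => rfl
  | succ n ih => simp only [avg, ih, ← Finset.sum_add_distrib, Finset.sum_div]

theorem avg_length_add (m n : ℕ) (f : List Bool → ℝ) :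
    avg (m + n) f = avg m (fun u => avg n (fun v => f (u ++ v))) := by
  induction m generalizing f with
  | zero => simp [avg]
  | succ m ih =>
    rw [Nat.succ_add]
    simp only [avg, ih, List.cons_append]

theorem avg_succ_last (n : ℕ) (f : List Bool → ℝ) :
    avg (n + 1) f = avg n (fun u => (f (u ++ [true]) + f (u ++ [false])) / 2) := by
  rw [avg_length_add]
  rfl

theorem avg_map_not (n : ℕ) (f : List Bool → ℝ) :
    avg n (fun w => f (w.map not)) = avg n f := by
  induction n generalizing f with
  | zero => rfl
  | succ n ih =>
    simp only [avg, List.map_cons, Bool.not_true, Bool.not_false]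
    rw [ih (fun w => f (false :: w)), ih (fun w => f (true :: w)), add_comm]

open Classical in
/-- Probability of `p` under the uniform distribution on words of length `n`. -/
noncomputable def pr (n : ℕ) (p : List Bool → Prop) : ℝ :=
  avg n (fun w => if p w then 1 else 0)

theorem pr_congr {n : ℕ} {p q : List Bool → Prop} (h : ∀ w, w.length = n → (p w ↔ q w)) :
    pr n p = pr n q :=
  by
  classical
  exact avg_congr fun w hw => if_congr (h w hw) rfl rfl

theorem pr_mono {n : ℕ} {p q : List Bool → Prop} (h : ∀ w, w.length = n → p w → q w) :
    pr n p ≤ pr n q :=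
  avg_mono fun w hw => by
    by_cases h1 : p w
    · simp [h1, h w hw h1]
    · by_cases h2 : q w <;> simp [h1, h2]

theorem pr_nonneg (n : ℕ) (p : List Bool → Prop) : 0 ≤ pr n p := by
  rw [← avg_const n 0]
  exact avg_mono fun w _ => by positivity

theorem pr_true (n : ℕ) : pr n (fun _ => True) = 1 := by
  simp [pr]

theorem pr_le_one (n : ℕ) (p : List Bool → Prop) : pr n p ≤ 1 :=
  (pr_mono fun _ _ _ => trivial).trans_eq (pr_true n)

theorem pr_or {n : ℕ} {p q r : List Bool → Prop} (h : ∀ w, w.length = n → (r w ↔ p w ∨ q w))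
    (h' : ∀ w, w.length = n → p w → ¬ q w) : pr n r = pr n p + pr n q := by
  simp only [pr, ← avg_add]
  refine avg_congr fun w hw => ?_
  have h1 := h w hw
  have h2 := h' w hw
  by_cases hp : p w <;> by_cases hq : q w <;> simp_all

theorem pr_map_not (n : ℕ) (p : List Bool → Prop) : pr n (fun w => p (w.map not)) = pr n p := by
  classical
  exact avg_map_not n (fun w => if p w then 1 else 0)

/-! ### Generating functions and unique factorization. -/

/-- Generating function of the probabilities `pr n p`. -/
noncomputable def gf (p : List Bool → Prop) : PowerSeries ℝ := PowerSeries.mk fun n => pr n p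

@[simp] theorem coeff_gf (p : List Bool → Prop) (n : ℕ) :
    PowerSeries.coeff n (gf p) = pr n p := PowerSeries.coeff_mk _ _

theorem gf_or {p q r : List Bool → Prop} (h : ∀ w, r w ↔ p w ∨ q w)
    (h' : ∀ w, p w → ¬ q w) : gf r = gf p + gf q := by
  ext n
  simpa using pr_or (fun w _ => h w) (fun w _ => h' w)

theorem pr_split_at {t j : ℕ} (b : Bool) (A B p : List Bool → Prop)
    (hp : ∀ u c v, u.length = t → (p (u ++ c :: v) ↔ c = b ∧ A u ∧ B v)) :
    pr (t + (j + 1)) p = pr t A * pr j B / 2 := by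
  classical
  have key : pr (t + (j + 1)) p = avg t (fun u => (pr j B / 2) * (if A u then 1 else 0)) := by
    unfold pr
    rw [avg_length_add]
    refine avg_congr fun u hu => ?_
    simp only [avg, hp u _ _ hu]
    by_cases hA : A u <;> cases b <;> simp [hA]
  rw [key, avg_mul_left]
  unfold pr
  ring

/-- Unique factorization of the words with property `p` as `u ++ b :: v` translates into a product
of generating functions. -/
theorem gf_eq_of_unique_split (b : Bool) (A B p : List Bool → Prop)
    (hp : ∀ w, p w ↔ ∃ u v, w = u ++ b :: v ∧ A u ∧ B v)
    (huniq : ∀ u v u' v', u ++ b :: v = u' ++ b :: v' → A u → B v → A u' → B v' →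
      u.length = u'.length) :
    gf p = (1 / 2 : ℝ) • (PowerSeries.X * (gf A * gf B)) := by
  classical
  ext n
  rw [coeff_gf, PowerSeries.coeff_smul, smul_eq_mul]
  -- Sort the words by the position t of the distinguished letter; uniqueness makes these events
  -- disjoint, and each has the product probability of `pr_split_at`.
  let pt : ℕ → List Bool → Prop := fun t w => ∃ u v, w = u ++ b :: v ∧ u.length = t ∧ A u ∧ B v
  have h1 : pr n p = ∑ t ∈ Finset.range n, pr n (pt t) := by
    unfold pr
    rw [← avg_sum]
    refine avg_congr fun w hw => ?_
    by_cases h : p w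
    · obtain ⟨u, v, rfl, hA, hB⟩ := (hp w).1 h
      have hlen : u.length < n := by rw [← hw]; simp
      rw [Finset.sum_eq_single_of_mem u.length (Finset.mem_range.2 hlen), if_pos h, if_pos]
      · exact ⟨u, v, rfl, rfl, hA, hB⟩
      · intro t _ ht
        rw [if_neg]
        rintro ⟨u', v', he, rfl, hA', hB'⟩
        exact ht (huniq _ _ _ _ he hA hB hA' hB').symm
    · rw [if_neg h, Finset.sum_eq_zero]
      intro t _
      rw [if_neg]
      rintro ⟨u, v, rfl, _, hA, hB⟩
      exact h ((hp _).2 ⟨u, v, rfl, hA, hB⟩)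
  have h2 : ∀ t j, pr (t + (j + 1)) (pt t) = pr t A * pr j B / 2 := by
    intro t j
    refine pr_split_at b A B (pt t) fun u c v hu => ⟨?_, ?_⟩
    · rintro ⟨u', v', he, hl, hA, hB⟩
      obtain ⟨rfl, h3⟩ := List.append_inj he (hu.trans hl.symm)
      obtain ⟨rfl, rfl⟩ := List.cons_eq_cons.1 h3
      exact ⟨rfl, hA, hB⟩
    · rintro ⟨rfl, hA, hB⟩
      exact ⟨u, v, rfl, hu, hA, hB⟩
  rw [h1]
  cases n with
  | zero => simp
  | succ n =>
    rw [PowerSeries.coeff_succ_X_mul, PowerSeries.coeff_mul,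
      Finset.Nat.sum_antidiagonal_eq_sum_range_succ_mk, Finset.mul_sum]
    refine Finset.sum_congr rfl fun t ht => ?_
    have : n + 1 = t + ((n - t) + 1) := by have := Finset.mem_range.1 ht; omega
    rw [this, h2, coeff_gf, coeff_gf]
    ring

/-! ### Cut steps and their behaviour under concatenation. -/

/-- The path never goes below its starting point. -/
def StaysNonneg (w : List Bool) : Prop := ∀ i, 0 ≤ ht (w.take i)

/-- The path never goes above its endpoint. -/
def EndsAtMax (w : List Bool) : Prop := ∀ i, 0 ≤ ht (w.drop i)

/-- The path stays between its starting point and its endpoint. -/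
def IsBridge (w : List Bool) : Prop := StaysNonneg w ∧ EndsAtMax w

theorem StaysNonneg.ht_nonneg {w : List Bool} (h : StaysNonneg w) : 0 ≤ ht w := by
  simpa using h w.length

theorem EndsAtMax.ht_nonneg {w : List Bool} (h : EndsAtMax w) : 0 ≤ ht w := by
  simpa using h 0

theorem StaysNonneg.of_append {u v : List Bool} (h : StaysNonneg (u ++ v)) : StaysNonneg u := by
  intro i
  have := h (min i u.length)
  rw [List.take_append_of_le_length (min_le_right _ _)] at this
  rcases le_total i u.length with hi | hi
  · rwa [min_eq_left hi] at this
  · rw [min_eq_right hi] at this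
    rwa [List.take_of_length_le hi, ← List.take_length (l := u)]

theorem StaysNonneg.append {u v : List Bool} (hu : StaysNonneg u) (hv : StaysNonneg v) :
    StaysNonneg (u ++ v) := by
  intro i
  rw [List.take_append, ht_append]
  exact add_nonneg (hu i) (hv _)

theorem StaysNonneg.cons_true {v : List Bool} (hv : StaysNonneg v) :
    StaysNonneg (true :: v) := by
  intro i
  cases i with
  | zero => simp
  | succ i =>
    have := hv i
    simp only [List.take_succ_cons, ht_cons, letterStep_true]
    omega

theorem EndsAtMax.of_append {u v : List Bool} (h : EndsAtMax (u ++ v)) : EndsAtMax v := by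
  intro i
  have := h (u.length + i)
  rwa [List.drop_append, List.drop_of_length_le (by omega), List.nil_append,
    Nat.add_sub_cancel_left] at this

theorem EndsAtMax.append {u v : List Bool} (hu : EndsAtMax u) (hv : EndsAtMax v) :
    EndsAtMax (u ++ v) := by
  intro i
  rw [List.drop_append, ht_append]
  exact add_nonneg (hu i) (hv _)

theorem EndsAtMax.cons_true {v : List Bool} (hv : EndsAtMax v) : EndsAtMax (true :: v) := by
  intro i
  cases i with
  | zero =>
    have := hv.ht_nonneg
    simp only [List.drop_zero, ht_cons, letterStep_true]
    omega
  | succ i => simpa using hv i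

theorem EndsAtMax.of_cons {b : Bool} {v : List Bool} (h : EndsAtMax (b :: v)) : EndsAtMax v :=
  EndsAtMax.of_append (u := [b]) h

/-- The step number `t` of `w` goes up and separates the past from the future. -/
def IsCut (w : List Bool) (t : ℕ) : Prop :=
  w[t]? = some true ∧ EndsAtMax (w.take t) ∧ StaysNonneg (w.drop (t + 1))

open Classical in
/-- Number of cut steps of `w`. -/
noncomputable def numCuts (w : List Bool) : ℕ :=
  ((Finset.range w.length).filter (IsCut w)).card

theorem IsCut.lt {w : List Bool} {t : ℕ} (h : IsCut w t) : t < w.length := by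
  have := h.1
  rw [List.getElem?_eq_some_iff] at this
  exact this.1

theorem isCut_append_cons {u v : List Bool} (hu : EndsAtMax u) (hv : StaysNonneg v) :
    IsCut (u ++ true :: v) u.length := by
  refine ⟨by simp, by simpa using hu, ?_⟩
  rw [List.drop_append, List.drop_of_length_le (by omega)]
  simpa using hv

theorem IsCut.exists_split {w : List Bool} {t : ℕ} (h : IsCut w t) :
    ∃ u v, w = u ++ true :: v ∧ u.length = t ∧ EndsAtMax u ∧ StaysNonneg v := by
  refine ⟨w.take t, w.drop (t + 1), ?_, ?_, h.2.1, h.2.2⟩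
  · have h1 := h.1
    rw [List.getElem?_eq_some_iff] at h1
    obtain ⟨h2, h3⟩ := h1
    rw [← h3, List.getElem_cons_drop, List.take_append_drop]
  · simpa using h.lt.le

/-- The suffix `true :: v` never goes below the endpoint of `u`, so it cannot affect the condition
on the future of a step of `u`. -/
theorem isCut_append_cons_left {u v : List Bool} (hv : StaysNonneg v) {t : ℕ}
    (ht : t < u.length) : IsCut (u ++ true :: v) t ↔ IsCut u t := by
  unfold IsCut
  rw [List.getElem?_append_left ht, List.take_append_of_le_length ht.le,
    List.drop_append_of_le_length ht]
  have : StaysNonneg (u.drop (t + 1) ++ true :: v) ↔ StaysNonneg (u.drop (t + 1)) :=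
    ⟨StaysNonneg.of_append, fun h => h.append hv.cons_true⟩
  rw [this]

theorem isCut_append_cons_right {u v : List Bool} (hu : EndsAtMax u) (t : ℕ) :
    IsCut (u ++ true :: v) (u.length + 1 + t) ↔ IsCut v t := by
  unfold IsCut
  have e1 : (u ++ true :: v)[u.length + 1 + t]? = v[t]? := by
    rw [List.getElem?_append_right (by omega)]
    have : u.length + 1 + t - u.length = t + 1 := by omega
    rw [this, List.getElem?_cons_succ]
  have e2 : (u ++ true :: v).take (u.length + 1 + t) = u ++ true :: v.take t := by
    rw [List.take_append, List.take_of_length_le (by omega)]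
    have : u.length + 1 + t - u.length = t + 1 := by omega
    rw [this, List.take_succ_cons]
  have e3 : (u ++ true :: v).drop (u.length + 1 + t + 1) = v.drop (t + 1) := by
    rw [List.drop_append, List.drop_of_length_le (by omega)]
    have : u.length + 1 + t + 1 - u.length = t + 1 + 1 := by omega
    rw [this, List.drop_succ_cons, List.nil_append]
  rw [e1, e2, e3]
  have : EndsAtMax (u ++ true :: v.take t) ↔ EndsAtMax (v.take t) :=
    ⟨fun h => h.of_append.of_cons, fun h => hu.append h.cons_true⟩
  rw [this]

/-- This additivity turns counting cuts into taking powers of a generating function. -/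
theorem numCuts_append_cons {u v : List Bool} (hu : EndsAtMax u) (hv : StaysNonneg v) :
    numCuts (u ++ true :: v) = numCuts u + 1 + numCuts v := by
  classical
  have hlen : (u ++ true :: v).length = u.length + 1 + v.length := by simp; omega
  simp only [numCuts, Finset.card_filter, hlen]
  rw [Finset.sum_range_add, Finset.sum_range_succ, if_pos (isCut_append_cons hu hv)]
  congr 1
  · congr 1
    refine Finset.sum_congr rfl fun t ht => ?_
    simp only [isCut_append_cons_left hv (Finset.mem_range.1 ht)]
  · refine Finset.sum_congr rfl fun t _ => ?_
    simp only [isCut_append_cons_right hu]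

theorem numCuts_ne_zero_iff {w : List Bool} : numCuts w ≠ 0 ↔ ∃ t, IsCut w t := by
  classical
  rw [numCuts, Finset.card_ne_zero, Finset.filter_nonempty_iff]
  exact ⟨fun ⟨t, _, h⟩ => ⟨t, h⟩, fun ⟨t, h⟩ => ⟨t, Finset.mem_range.2 h.lt, h⟩⟩

theorem exists_first_cut {w : List Bool} (h : numCuts w ≠ 0) :
    ∃ u v, w = u ++ true :: v ∧ EndsAtMax u ∧ numCuts u = 0 ∧ StaysNonneg v := by
  classical
  have hex := numCuts_ne_zero_iff.1 h
  obtain ⟨u, v, hw, hl, hu, hv⟩ := (Nat.find_spec hex).exists_split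
  refine ⟨u, v, hw, hu, ?_, hv⟩
  by_contra hne
  obtain ⟨s, hs⟩ := numCuts_ne_zero_iff.1 hne
  refine Nat.find_min hex (hl ▸ hs.lt) ?_
  rw [hw]
  exact (isCut_append_cons_left hv hs.lt).2 hs

theorem exists_of_append_cons_eq {b : Bool} {u v u' v' : List Bool}
    (h : u ++ b :: v = u' ++ b :: v') (hlt : u.length < u'.length) :
    ∃ z, u' = u ++ b :: z ∧ v = z ++ b :: v' := by
  rcases List.append_eq_append_iff.1 h with ⟨a, h1, h2⟩ | ⟨a, h1, _⟩
  · cases a with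
    | nil => simp [h1] at hlt
    | cons c z =>
      obtain ⟨rfl, h3⟩ := List.cons_eq_cons.1 h2
      exact ⟨z, h1, h3⟩
  · rw [h1] at hlt
    simp at hlt

/-- If the two positions differed, the earlier one would be a cut of the longer prefix, which has
none. -/
theorem first_cut_unique {u v u' v' : List Bool} (h : u ++ true :: v = u' ++ true :: v')
    (hu : EndsAtMax u) (hv : StaysNonneg v) (hu0 : numCuts u = 0)
    (hu' : EndsAtMax u') (hv' : StaysNonneg v') (hu0' : numCuts u' = 0) :
    u.length = u'.length := by
  rcases lt_trichotomy u.length u'.length with hlt | he | hlt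
  · obtain ⟨z, rfl, rfl⟩ := exists_of_append_cons_eq h hlt
    rw [numCuts_append_cons hu hv.of_append] at hu0'
    omega
  · exact he
  · obtain ⟨z, rfl, rfl⟩ := exists_of_append_cons_eq h.symm hlt
    rw [numCuts_append_cons hu' hv'.of_append] at hu0
    omega

/-! ### Irreducible bridges and renewal decompositions. -/

/-- Bridges without cuts. -/
def IsIrreducible (w : List Bool) : Prop := IsBridge w ∧ numCuts w = 0

/-- Common form of the first-cut decompositions below, which differ only in the condition `B` on
what follows the first cut. -/
theorem gf_first_cut (A B : List Bool → Prop) (hB : ∀ w, B w → StaysNonneg w)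
    (hA : ∀ w, A w ↔ StaysNonneg w ∧ numCuts w ≠ 0 ∧ ∃ u v, w = u ++ true :: v ∧
      IsIrreducible u ∧ B v) :
    gf A = (1 / 2 : ℝ) • (PowerSeries.X * (gf IsIrreducible * gf B)) := by
  refine gf_eq_of_unique_split true _ _ _ (fun w => ?_) ?_
  · rw [hA]
    refine ⟨fun h => h.2.2, ?_⟩
    rintro ⟨u, v, rfl, hu, hv⟩
    refine ⟨hu.1.1.append (hB v hv).cons_true, ?_, u, v, rfl, hu, hv⟩
    rw [numCuts_append_cons hu.1.2 (hB v hv)]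
    omega
  · intro u v u' v' h hu hv hu' hv'
    exact first_cut_unique h hu.1.2 (hB v hv) hu.2 hu'.1.2 (hB v' hv') hu'.2

theorem gf_staysNonneg_numCuts_succ (i : ℕ) :
    gf (fun w => StaysNonneg w ∧ numCuts w = i + 1) =
      (1 / 2 : ℝ) • (PowerSeries.X *
        (gf IsIrreducible * gf (fun w => StaysNonneg w ∧ numCuts w = i))) := by
  refine gf_first_cut _ _ (fun w h => h.1) fun w => ⟨?_, ?_⟩
  · rintro ⟨hw, hk⟩
    have h0 : numCuts w ≠ 0 := by omega
    refine ⟨hw, h0, ?_⟩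
    obtain ⟨u, v, rfl, hu, hu0, hv⟩ := exists_first_cut h0
    rw [numCuts_append_cons hu hv] at hk
    exact ⟨u, v, rfl, ⟨⟨hw.of_append, hu⟩, hu0⟩, hv, by omega⟩
  · rintro ⟨hw, h0, u, v, rfl, hu, hv, hk⟩
    refine ⟨hw, ?_⟩
    rw [numCuts_append_cons hu.1.2 hv, hu.2]
    omega

theorem gf_staysNonneg :
    gf StaysNonneg = gf (fun w => StaysNonneg w ∧ numCuts w = 0) +
      (1 / 2 : ℝ) • (PowerSeries.X * (gf IsIrreducible * gf StaysNonneg)) := by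
  rw [← gf_first_cut (fun w => StaysNonneg w ∧ numCuts w ≠ 0) StaysNonneg (fun w h => h)]
  · exact gf_or (fun w => by tauto) (fun w h => by tauto)
  · intro w
    refine ⟨?_, fun h => ⟨h.1, h.2.1⟩⟩
    rintro ⟨hw, h0⟩
    refine ⟨hw, h0, ?_⟩
    obtain ⟨u, v, rfl, hu, hu0, hv⟩ := exists_first_cut h0
    exact ⟨u, v, rfl, ⟨⟨hw.of_append, hu⟩, hu0⟩, hv⟩

theorem gf_isBridge :
    gf IsBridge = gf IsIrreducible +
      (1 / 2 : ℝ) • (PowerSeries.X * (gf IsIrreducible * gf IsBridge)) := by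
  rw [← gf_first_cut (fun w => IsBridge w ∧ numCuts w ≠ 0) IsBridge (fun w h => h.1)]
  · exact gf_or (fun w => by unfold IsIrreducible; tauto)
      (fun w h => by unfold IsIrreducible at h; tauto)
  · intro w
    constructor
    · rintro ⟨hw, h0⟩
      refine ⟨hw.1, h0, ?_⟩
      obtain ⟨u, v, rfl, hu, hu0, hv⟩ := exists_first_cut h0
      exact ⟨u, v, rfl, ⟨⟨hw.1.of_append, hu⟩, hu0⟩, hv, hw.2.of_append.of_cons⟩
    · rintro ⟨hw, h0, u, v, rfl, hu, hv⟩
      exact ⟨⟨hw, hu.1.2.append hv.2.cons_true⟩, h0⟩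

/-- Removing first cuts one at a time lowers the number of cuts on the right by one, until exactly i
are left. -/
theorem exists_split_numCuts_right {i : ℕ} {w : List Bool} (h : i + 1 ≤ numCuts w) :
    ∃ u v, w = u ++ true :: v ∧ EndsAtMax u ∧ StaysNonneg v ∧ numCuts v = i := by
  induction hn : w.length using Nat.strong_induction_on generalizing w with
  | _ n ih =>
    obtain ⟨u, v, rfl, hu, hu0, hv⟩ := exists_first_cut (w := w) (by omega)
    rw [numCuts_append_cons hu hv, hu0] at h
    rcases eq_or_ne (numCuts v) i with he | hne
    · exact ⟨u, v, rfl, hu, hv, he⟩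
    · obtain ⟨u', v', rfl, hu', hv', hi⟩ :=
        ih v.length (by rw [← hn]; simp; omega) (w := v) (by omega) rfl
      exact ⟨u ++ true :: u', v', by simp, hu.append hu'.cons_true, hv', hi⟩

/-- The marked step is the cut number i + 1 counted from the right. The prefix may contain any
number of cuts, so no condition on `numCuts u` appears, and the exact count on the right gives
uniqueness. -/
theorem gf_numCuts_ge (i : ℕ) :
    gf (fun w => i + 1 ≤ numCuts w) =
      (1 / 2 : ℝ) • (PowerSeries.X *
        (gf EndsAtMax * gf (fun w => StaysNonneg w ∧ numCuts w = i))) := by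
  refine gf_eq_of_unique_split true _ _ _ (fun w => ⟨?_, ?_⟩) ?_
  · intro h
    obtain ⟨u, v, rfl, hu, hv, hi⟩ := exists_split_numCuts_right h
    exact ⟨u, v, rfl, hu, hv, hi⟩
  · rintro ⟨u, v, rfl, hu, hv, hi⟩
    rw [numCuts_append_cons hu hv]
    omega
  · intro u v u' v' h hu hv hu' hv'
    rcases lt_trichotomy u.length u'.length with hlt | he | hlt
    · obtain ⟨z, rfl, rfl⟩ := exists_of_append_cons_eq h hlt
      have := hv.2
      rw [numCuts_append_cons hu'.of_append.of_cons hv'.1, hv'.2] at this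
      omega
    · exact he
    · obtain ⟨z, rfl, rfl⟩ := exists_of_append_cons_eq h.symm hlt
      have := hv'.2
      rw [numCuts_append_cons hu.of_append.of_cons hv.1, hv.2] at this
      omega

/-! ### Decomposition at the first visit to the minimum. -/

/-- No suffix of the word has positive increment. -/
def EndsAtMin (w : List Bool) : Prop := ∀ i, ht (w.drop i) ≤ 0

theorem ht_map_not (w : List Bool) : ht (w.map not) = -ht w := by
  induction w with
  | nil => simp
  | cons b w ih =>
    rw [List.map_cons, ht_cons, ht_cons, ih]
    cases b <;> simp <;> ring

theorem gf_endsAtMin : gf EndsAtMin = gf EndsAtMax := by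
  ext n
  rw [coeff_gf, coeff_gf, ← pr_map_not]
  refine pr_congr fun w _ => forall_congr' fun i => ?_
  rw [← List.map_drop, ht_map_not]
  omega

theorem exists_first_min {w : List Bool} (h : ¬ StaysNonneg w) :
    ∃ u v, w = u ++ false :: v ∧ EndsAtMin u ∧ StaysNonneg v := by
  induction w with
  | nil => exact absurd (fun i => by simp) h
  | cons b w ih =>
    by_cases hw : StaysNonneg w
    · cases b with
      | true => exact absurd hw.cons_true h
      | false => exact ⟨[], w, rfl, fun i => by simp, hw⟩
    · obtain ⟨u, v, rfl, hu, hv⟩ := ih hw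
      -- Prepending `b` spoils the decomposition only if `b` is up and `u` has total increment 0;
      -- the new path then returns exactly to its start at the old minimum, and so stays
      -- nonnegative.
      by_cases hbu : 0 < ht (b :: u)
      · refine absurd ?_ h
        have hb : ht (b :: u) = letterStep b + ht u := ht_cons b u
        have hu0 := hu 0
        rw [List.drop_zero] at hu0
        have hb1 : b = true ∧ ht u = 0 := by
          cases b
          · rw [letterStep_false] at hb; omega
          · rw [letterStep_true] at hb; exact ⟨rfl, by omega⟩
        obtain ⟨rfl, hu1⟩ := hb1
        have hpre : StaysNonneg u := by
          intro i
          have h1 := hu i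
          have h2 : ht (u.take i) + ht (u.drop i) = ht u := by
            rw [← ht_append, List.take_append_drop]
          omega
        have : true :: (u ++ false :: v) = (true :: u ++ [false]) ++ v := by simp
        rw [this]
        refine StaysNonneg.append ?_ hv
        intro i
        rw [List.take_append, ht_append]
        have h3 := hpre.cons_true i
        rcases Nat.eq_zero_or_pos (i - (true :: u).length) with h4 | h4
        · rw [h4]; simpa using h3
        · rw [List.take_of_length_le (by omega), List.take_of_length_le (l := [false]) (by simp only [List.length_singleton]; omega)]
          simp [hu1]
      · refine ⟨b :: u, v, rfl, ?_, hv⟩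
        intro i
        cases i with
        | zero => rw [List.drop_zero]; omega
        | succ i => simpa using hu i

/-- A path that goes below its start has a down step arriving at its minimum for the first time. By
reflection the prefix before that step has the same series as `EndsAtMax`, so the right side is also
the series of the expected number of up-cuts. -/
theorem gf_not_staysNonneg :
    gf (fun w => ¬ StaysNonneg w) =
      (1 / 2 : ℝ) • (PowerSeries.X * (gf EndsAtMax * gf StaysNonneg)) := by
  rw [← gf_endsAtMin]
  have key : ∀ u z v : List Bool, EndsAtMin (u ++ false :: z) →
      StaysNonneg (z ++ false :: v) → False := by
    intro u z v h1 h2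
    have h3 := h1 (u.length + 1)
    have h4 := h2 (z.length + 1)
    rw [List.drop_append] at h3
    rw [List.take_append] at h4
    have h5 := h1 u.length
    have h6 := h2.of_append.ht_nonneg
    have e1 : u.length + 1 - u.length = 1 := by omega
    have e2 : z.length + 1 - z.length = 1 := by omega
    rw [e1, List.drop_of_length_le (by omega)] at h3
    rw [e2, List.take_of_length_le (by omega)] at h4
    simp at h3 h4
    omega
  refine gf_eq_of_unique_split false _ _ _ (fun w => ⟨exists_first_min, ?_⟩) ?_
  · rintro ⟨u, v, rfl, hu, hv⟩ h
    have h1 := h (u.length + 1)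
    rw [List.take_append] at h1
    have e : u.length + 1 - u.length = 1 := by omega
    have h2 := hu 0
    rw [e, List.take_of_length_le (by omega)] at h1
    simp at h1 h2
    omega
  · intro u v u' v' h hu hv hu' hv'
    rcases lt_trichotomy u.length u'.length with hlt | he | hlt
    · obtain ⟨z, rfl, rfl⟩ := exists_of_append_cons_eq h hlt
      exact (key _ _ _ hu' hv).elim
    · exact he
    · obtain ⟨z, rfl, rfl⟩ := exists_of_append_cons_eq h.symm hlt
      exact (key _ _ _ hu hv').elim

/-! ### Partial sums of coefficients of power series. -/

/-- Sum of the coefficients of order at most `n`. -/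
noncomputable def psum (n : ℕ) (A : PowerSeries ℝ) : ℝ :=
  ∑ l ∈ Finset.range (n + 1), PowerSeries.coeff l A

/-- All coefficients are nonnegative. -/
def CoeffNonneg (A : PowerSeries ℝ) : Prop := ∀ n, 0 ≤ PowerSeries.coeff n A

theorem CoeffNonneg.mul {A B : PowerSeries ℝ} (hA : CoeffNonneg A) (hB : CoeffNonneg B) :
    CoeffNonneg (A * B) := fun n => by
  rw [PowerSeries.coeff_mul]
  exact Finset.sum_nonneg fun p _ => mul_nonneg (hA _) (hB _)

theorem coeffNonneg_one : CoeffNonneg 1 := fun n => by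
  rw [PowerSeries.coeff_one]
  positivity

theorem coeffNonneg_X : CoeffNonneg PowerSeries.X := fun n => by
  rw [PowerSeries.coeff_X]
  positivity

theorem CoeffNonneg.pow {A : PowerSeries ℝ} (hA : CoeffNonneg A) (i : ℕ) :
    CoeffNonneg (A ^ i) := by
  induction i with
  | zero => rw [pow_zero]; exact coeffNonneg_one
  | succ i ih => rw [pow_succ]; exact ih.mul hA

theorem CoeffNonneg.smul {A : PowerSeries ℝ} (hA : CoeffNonneg A) {c : ℝ} (hc : 0 ≤ c) :
    CoeffNonneg (c • A) := fun n => by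
  rw [PowerSeries.coeff_smul]
  exact mul_nonneg hc (hA n)

theorem coeffNonneg_gf (p : List Bool → Prop) : CoeffNonneg (gf p) := fun n => by
  rw [coeff_gf]
  exact pr_nonneg _ _

theorem CoeffNonneg.psum_nonneg {A : PowerSeries ℝ} (hA : CoeffNonneg A) (n : ℕ) :
    0 ≤ psum n A := Finset.sum_nonneg fun _ _ => hA _

theorem CoeffNonneg.psum_mono {A : PowerSeries ℝ} (hA : CoeffNonneg A) {m n : ℕ} (h : m ≤ n) :
    psum m A ≤ psum n A :=
  Finset.sum_le_sum_of_subset_of_nonneg (Finset.range_mono (by omega)) fun _ _ _ => hA _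

theorem psum_add (n : ℕ) (A B : PowerSeries ℝ) : psum n (A + B) = psum n A + psum n B := by
  simp [psum, Finset.sum_add_distrib]

theorem psum_one (n : ℕ) : psum n 1 = 1 := by
  rw [psum, Finset.sum_eq_single_of_mem 0 (by simp)]
  · simp
  · intro l _ hl
    rw [PowerSeries.coeff_one, if_neg hl]

theorem psum_sum {ι : Type*} (n : ℕ) (s : Finset ι) (A : ι → PowerSeries ℝ) :
    psum n (∑ i ∈ s, A i) = ∑ i ∈ s, psum n (A i) := by
  simp only [psum, map_sum]
  exact Finset.sum_comm

/-- Partial summation is multiplication by 1 / (1 - X), which reduces partial sums of products to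
associativity. -/
theorem psum_eq_coeff_mul (n : ℕ) (A : PowerSeries ℝ) :
    psum n A = PowerSeries.coeff n (A * PowerSeries.mk 1) := by
  rw [PowerSeries.coeff_mul, Finset.Nat.sum_antidiagonal_eq_sum_range_succ_mk]
  simp [psum]

theorem psum_mul (n : ℕ) (A B : PowerSeries ℝ) :
    psum n (A * B) = ∑ l ∈ Finset.range (n + 1), PowerSeries.coeff l A * psum (n - l) B := by
  rw [psum_eq_coeff_mul, mul_assoc, PowerSeries.coeff_mul,
    Finset.Nat.sum_antidiagonal_eq_sum_range_succ_mk]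
  simp only [← psum_eq_coeff_mul]

/-- If a sum of two lengths is at most n, so is each of them. -/
theorem psum_mul_le {A B : PowerSeries ℝ} (hA : CoeffNonneg A) (hB : CoeffNonneg B) (n : ℕ) :
    psum n (A * B) ≤ psum n A * psum n B := by
  rw [psum_mul, psum, Finset.sum_mul]
  exact Finset.sum_le_sum fun l _ =>
    mul_le_mul_of_nonneg_left (hB.psum_mono (Nat.sub_le _ _)) (hA l)

theorem psum_mul_psum_le {A B : PowerSeries ℝ} (hA : CoeffNonneg A) (hB : CoeffNonneg B)
    (m n : ℕ) : psum m A * psum n B ≤ psum (m + n) (A * B) := by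
  rw [psum_mul, psum, Finset.sum_mul]
  refine le_trans (Finset.sum_le_sum fun l hl => ?_)
    (Finset.sum_le_sum_of_subset_of_nonneg
      (Finset.range_mono (show m + 1 ≤ m + n + 1 by omega))
      fun l _ _ => mul_nonneg (hA l) (hB.psum_nonneg _))
  exact mul_le_mul_of_nonneg_left (hB.psum_mono (by have := Finset.mem_range.1 hl; omega)) (hA l)

theorem psum_pow_le {A : PowerSeries ℝ} (hA : CoeffNonneg A) (n i : ℕ) :
    psum n (A ^ i) ≤ psum n A ^ i := by
  induction i with
  | zero => simp [psum_one]
  | succ i ih =>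
    rw [pow_succ, pow_succ]
    exact (psum_mul_le (hA.pow i) hA n).trans
      (mul_le_mul_of_nonneg_right ih (hA.psum_nonneg n))

/-- If each of i lengths is at most n, their sum is at most i n. With `psum_pow_le` this brackets
the partial sums of powers. -/
theorem pow_psum_le {A : PowerSeries ℝ} (hA : CoeffNonneg A) (n i : ℕ) :
    psum n A ^ i ≤ psum (i * n) (A ^ i) := by
  induction i with
  | zero => simp [psum_one]
  | succ i ih =>
    rw [pow_succ, pow_succ, Nat.succ_mul]
    exact (mul_le_mul_of_nonneg_right ih (hA.psum_nonneg n)).trans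
      (psum_mul_psum_le (hA.pow i) hA _ _)

/-! ### The tail of the number of cuts through the renewal series. -/

/-- Weights of an irreducible bridge followed (or preceded) by a cut step, by total length. -/
noncomputable def irrSeries : PowerSeries ℝ :=
  (1 / 2 : ℝ) • (PowerSeries.X * gf IsIrreducible)

/-- Renewal series of `irrSeries`. -/
noncomputable def bridgeSeries : PowerSeries ℝ :=
  1 + (1 / 2 : ℝ) • (PowerSeries.X * gf IsBridge)

theorem coeffNonneg_irrSeries : CoeffNonneg irrSeries :=
  (coeffNonneg_X.mul (coeffNonneg_gf _)).smul (by norm_num)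

theorem coeffNonneg_bridgeSeries : CoeffNonneg bridgeSeries := fun n => by
  rw [bridgeSeries, map_add]
  exact add_nonneg (coeffNonneg_one n)
    ((coeffNonneg_X.mul (coeffNonneg_gf _)).smul (by norm_num) n)

theorem bridgeSeries_eq : bridgeSeries = 1 + irrSeries * bridgeSeries := by
  have h := gf_isBridge
  have h2 : (1 / 2 : ℝ) • (PowerSeries.X * gf IsBridge) =
      (1 / 2 : ℝ) • (PowerSeries.X * (gf IsIrreducible +
      (1 / 2 : ℝ) • (PowerSeries.X * (gf IsIrreducible * gf IsBridge)))) := by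
    rw [← h]
  unfold bridgeSeries irrSeries
  simp only [PowerSeries.smul_eq_C_mul] at h2 ⊢
  linear_combination h2

theorem gf_staysNonneg_numCuts (i : ℕ) :
    gf (fun w => StaysNonneg w ∧ numCuts w = i) =
      irrSeries ^ i * ((1 - irrSeries) * gf StaysNonneg) := by
  induction i with
  | zero =>
    have h := gf_staysNonneg
    unfold irrSeries
    simp only [PowerSeries.smul_eq_C_mul] at h ⊢
    linear_combination -h
  | succ i ih =>
    rw [gf_staysNonneg_numCuts_succ, ih]
    unfold irrSeries
    simp only [PowerSeries.smul_eq_C_mul]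
    ring

/-- The first step must be up. -/
theorem pr_succ_staysNonneg_le (m : ℕ) : pr (m + 1) StaysNonneg ≤ 1 / 2 := by
  have h := pr_le_one m (fun w => StaysNonneg (true :: w))
  unfold pr at h ⊢
  have h2 : ∀ w, ¬ StaysNonneg (false :: w) := fun w hw => by
    have := hw 1
    simp at this
  simp only [avg, h2, if_false, avg_const]
  linarith

/-- Expected number of up-cuts of a word of length `m + 1`, as a series in `m`. -/
noncomputable def cutSeries : PowerSeries ℝ := (1 / 2 : ℝ) • (gf EndsAtMax * gf StaysNonneg)

theorem coeff_cutSeries (m : ℕ) :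
    PowerSeries.coeff m cutSeries = 1 - pr (m + 1) StaysNonneg := by
  have h1 : pr (m + 1) (fun _ => True) =
      pr (m + 1) StaysNonneg + pr (m + 1) (fun w => ¬ StaysNonneg w) :=
    pr_or (fun w _ => by tauto) (fun w _ => by tauto)
  rw [pr_true] at h1
  have h2 := congrArg (PowerSeries.coeff (m + 1)) gf_not_staysNonneg
  rw [coeff_gf, PowerSeries.coeff_smul, PowerSeries.coeff_succ_X_mul] at h2
  rw [cutSeries, PowerSeries.coeff_smul]
  linarith

theorem coeff_mul_cutSeries_le {A : PowerSeries ℝ} (hA : CoeffNonneg A) (m : ℕ) :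
    PowerSeries.coeff m (A * cutSeries) ≤ psum m A := by
  rw [PowerSeries.coeff_mul, Finset.Nat.sum_antidiagonal_eq_sum_range_succ_mk]
  refine Finset.sum_le_sum fun l _ => mul_le_of_le_one_right (hA l) ?_
  rw [coeff_cutSeries]
  linarith [pr_nonneg (m - l + 1) StaysNonneg]

theorem le_coeff_mul_cutSeries {A : PowerSeries ℝ} (hA : CoeffNonneg A) (m : ℕ) :
    psum m A / 2 ≤ PowerSeries.coeff m (A * cutSeries) := by
  rw [PowerSeries.coeff_mul, Finset.Nat.sum_antidiagonal_eq_sum_range_succ_mk, psum,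
    Finset.sum_div]
  refine Finset.sum_le_sum fun l _ => ?_
  rw [div_eq_mul_one_div]
  refine mul_le_mul_of_nonneg_left ?_ (hA l)
  rw [coeff_cutSeries]
  linarith [pr_succ_staysNonneg_le (m - l)]

theorem pr_numCuts_ge_eq (m i : ℕ) :
    pr (m + 1) (fun w => i + 1 ≤ numCuts w) =
      PowerSeries.coeff m (irrSeries ^ i * (1 - irrSeries) * cutSeries) := by
  rw [← coeff_gf, gf_numCuts_ge, PowerSeries.coeff_smul, PowerSeries.coeff_succ_X_mul,
    ← PowerSeries.coeff_smul, gf_staysNonneg_numCuts, cutSeries]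
  simp only [PowerSeries.smul_eq_C_mul]
  congr 1
  ring

/-- The term with `irrSeries ^ (i + 1)` enters with a minus sign and is dropped. -/
theorem pr_numCuts_ge_le (m i : ℕ) :
    pr (m + 1) (fun w => i + 1 ≤ numCuts w) ≤ psum m irrSeries ^ i := by
  have h1 := coeff_mul_cutSeries_le (coeffNonneg_irrSeries.pow i) m
  have h2 := psum_pow_le coeffNonneg_irrSeries m i
  have h3 : 0 ≤ PowerSeries.coeff m (irrSeries ^ (i + 1) * cutSeries) :=
    (coeffNonneg_irrSeries.pow _).mul
      (((coeffNonneg_gf _).mul (coeffNonneg_gf _)).smul (by norm_num)) m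
  have h4 : irrSeries ^ i * (1 - irrSeries) * cutSeries =
      irrSeries ^ i * cutSeries - irrSeries ^ (i + 1) * cutSeries := by ring
  rw [pr_numCuts_ge_eq, h4, map_sub]
  linarith

/-- The factor 1 - F prevents a direct lower bound. Summing the tails at i, ..., i + r - 1
telescopes it to 1 - F^r, and each of these tails is at most the first. -/
theorem le_mul_pr_numCuts_ge (m i r : ℕ) :
    psum m (irrSeries ^ i) * (1 / 2 - psum m irrSeries ^ r) ≤
      r * pr (m + 1) (fun w => i + 1 ≤ numCuts w) := by
  have h1 : ∑ s ∈ Finset.range r, pr (m + 1) (fun w => i + s + 1 ≤ numCuts w) ≤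
      r * pr (m + 1) (fun w => i + 1 ≤ numCuts w) := by
    refine (Finset.sum_le_card_nsmul (Finset.range r) _ _ fun s _ => ?_).trans_eq
      (by rw [Finset.card_range, nsmul_eq_mul])
    exact pr_mono fun w _ h => by omega
  have h2 : ∑ s ∈ Finset.range r, pr (m + 1) (fun w => i + s + 1 ≤ numCuts w) =
      PowerSeries.coeff m (irrSeries ^ i * cutSeries) -
        PowerSeries.coeff m (irrSeries ^ (i + r) * cutSeries) := by
    rw [← map_sub]
    simp only [pr_numCuts_ge_eq]
    rw [← map_sum]
    congr 1
    have h3 := geom_sum_mul_neg irrSeries r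
    simp only [pow_add, ← Finset.sum_mul, ← Finset.mul_sum]
    linear_combination irrSeries ^ i * cutSeries * h3
  have h4 := le_coeff_mul_cutSeries (coeffNonneg_irrSeries.pow i) m
  have h5 := coeff_mul_cutSeries_le (coeffNonneg_irrSeries.pow (i + r)) m
  have h6 : psum m (irrSeries ^ (i + r)) ≤ psum m (irrSeries ^ i) * psum m irrSeries ^ r := by
    rw [pow_add]
    exact (psum_mul_le (coeffNonneg_irrSeries.pow i) (coeffNonneg_irrSeries.pow r) m).trans
      (mul_le_mul_of_nonneg_left (psum_pow_le coeffNonneg_irrSeries m r)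
        ((coeffNonneg_irrSeries.pow i).psum_nonneg m))
  linarith

theorem psum_bridgeSeries_le (n : ℕ) :
    psum n bridgeSeries ≤ 1 + psum n irrSeries * psum n bridgeSeries := by
  have h := psum_mul_le coeffNonneg_irrSeries coeffNonneg_bridgeSeries n
  have h2 : psum n bridgeSeries = psum n (1 + irrSeries * bridgeSeries) := by
    rw [← bridgeSeries_eq]
  rw [psum_add, psum_one] at h2
  linarith

/-- The renewal series dominates its first K terms F^k, and fewer than K blocks of length at most n
have total length at most K n. -/
theorem geom_sum_psum_irrSeries_le (n K : ℕ) :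
    ∑ k ∈ Finset.range K, psum n irrSeries ^ k ≤ psum (K * n) bridgeSeries := by
  have h : bridgeSeries = ∑ k ∈ Finset.range K, irrSeries ^ k + irrSeries ^ K * bridgeSeries := by
    have h1 := geom_sum_mul_neg irrSeries K
    have h2 := bridgeSeries_eq
    have h3 : (1 - irrSeries) * bridgeSeries = 1 := by linear_combination h2
    linear_combination -bridgeSeries * h1 + (∑ k ∈ Finset.range K, irrSeries ^ k) * h3
  rw [h, psum_add, psum_sum]
  refine le_add_of_le_of_nonneg (Finset.sum_le_sum fun k hk => ?_) ?_
  · refine (pow_psum_le coeffNonneg_irrSeries n k).trans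
      ((coeffNonneg_irrSeries.pow k).psum_mono ?_)
    exact Nat.mul_le_mul_right _ (Finset.mem_range.1 hk).le
  · exact ((coeffNonneg_irrSeries.pow K).mul coeffNonneg_bridgeSeries).psum_nonneg _

theorem psum_bridgeSeries (n : ℕ) :
    psum n bridgeSeries = 1 + (∑ l ∈ Finset.range n, pr l IsBridge) / 2 := by
  rw [bridgeSeries, psum_add, psum_one, psum, Finset.sum_range_succ']
  simp only [PowerSeries.coeff_smul, PowerSeries.coeff_succ_X_mul, coeff_gf,
    PowerSeries.coeff_zero_X_mul, smul_eq_mul, ← Finset.mul_sum]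
  ring

/-! ### Bridges of a given height: the walk killed outside a strip. -/

/-- All heights of the path lie in `[0, k]`. -/
def InStrip (k : ℕ) (w : List Bool) : Prop := ∀ i, 0 ≤ ht (w.take i) ∧ ht (w.take i) ≤ k

theorem InStrip.ht_mem {k : ℕ} {w : List Bool} (h : InStrip k w) : 0 ≤ ht w ∧ ht w ≤ k := by
  simpa using h w.length

theorem InStrip.of_append {k : ℕ} {u v : List Bool} (h : InStrip k (u ++ v)) : InStrip k u := by
  intro i
  have := h (min i u.length)
  rw [List.take_append_of_le_length (min_le_right _ _)] at this
  rcases le_total i u.length with hi | hi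
  · rwa [min_eq_left hi] at this
  · rw [min_eq_right hi] at this
    rwa [List.take_of_length_le hi, ← List.take_length (l := u)]

theorem inStrip_append_singleton {k : ℕ} {u : List Bool} {b : Bool} :
    InStrip k (u ++ [b]) ↔
      InStrip k u ∧ (0 ≤ ht u + letterStep b ∧ ht u + letterStep b ≤ k) := by
  constructor
  · intro h
    exact ⟨h.of_append, by simpa using h.ht_mem⟩
  · rintro ⟨h, hb⟩ i
    rcases le_or_gt i u.length with hi | hi
    · rw [List.take_append_of_le_length hi]
      exact h i
    · rw [List.take_of_length_le (by simp; omega)]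
      simpa using hb

theorem isBridge_and_ht_eq {k : ℕ} {w : List Bool} :
    IsBridge w ∧ ht w = k ↔ InStrip k w ∧ ht w = k := by
  have key : ∀ i, ht (w.take i) + ht (w.drop i) = ht w := fun i => by
    rw [← ht_append, List.take_append_drop]
  constructor
  · rintro ⟨⟨h1, h2⟩, h3⟩
    refine ⟨fun i => ?_, h3⟩
    have := h1 i
    have := h2 i
    have := key i
    omega
  · rintro ⟨h1, h3⟩
    refine ⟨⟨fun i => (h1 i).1, fun i => ?_⟩, h3⟩
    have := h1 i
    have := key i
    omega

open Classical in
/-- Expectation of `φ (S_n)` for the walk killed on leaving `[0, k]`. -/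
noncomputable def stripAvg (k n : ℕ) (φ : ℤ → ℝ) : ℝ :=
  avg n (fun w => if InStrip k w then φ (ht w) else 0)

open Classical in
theorem stripAvg_succ (k n : ℕ) (φ : ℤ → ℝ) :
    stripAvg k (n + 1) φ = stripAvg k n (fun y =>
      ((if 0 ≤ y + 1 ∧ y + 1 ≤ k then φ (y + 1) else 0) +
        (if 0 ≤ y - 1 ∧ y - 1 ≤ k then φ (y - 1) else 0)) / 2) := by
  unfold stripAvg
  rw [avg_succ_last]
  refine avg_congr fun w _ => ?_
  simp only [inStrip_append_singleton, ht_append, ht_cons, ht_nil, letterStep_true,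
    letterStep_false, add_zero]
  by_cases h : InStrip k w
  · simp only [h, true_and, if_true, sub_eq_add_neg]
  · simp [h]

theorem stripAvg_congr {k n : ℕ} {φ ψ : ℤ → ℝ} (h : ∀ y : ℤ, 0 ≤ y → y ≤ k → φ y = ψ y) :
    stripAvg k n φ = stripAvg k n ψ := by
  refine avg_congr fun w _ => ?_
  split_ifs with hw
  · exact h _ hw.ht_mem.1 hw.ht_mem.2
  · rfl

theorem stripAvg_sub (k n : ℕ) (φ ψ : ℤ → ℝ) :
    stripAvg k n (fun y => φ y - ψ y) = stripAvg k n φ - stripAvg k n ψ := by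
  unfold stripAvg
  rw [← avg_sub]
  refine avg_congr fun w _ => ?_
  split_ifs <;> simp

theorem stripAvg_mul_left (k n : ℕ) (c : ℝ) (φ : ℤ → ℝ) :
    stripAvg k n (fun y => c * φ y) = c * stripAvg k n φ := by
  unfold stripAvg
  rw [← avg_mul_left]
  refine avg_congr fun w _ => ?_
  split_ifs <;> simp

theorem stripAvg_mono {k n : ℕ} {φ ψ : ℤ → ℝ} (h : ∀ y : ℤ, 0 ≤ y → y ≤ k → φ y ≤ ψ y) :
    stripAvg k n φ ≤ stripAvg k n ψ := by
  refine avg_mono fun w _ => ?_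
  split_ifs with hw
  · exact h _ hw.ht_mem.1 hw.ht_mem.2
  · rfl

theorem stripAvg_one (k n : ℕ) : stripAvg k n (fun _ => 1) = pr n (InStrip k) := rfl

theorem stripAvg_zero (k : ℕ) (φ : ℤ → ℝ) : stripAvg k 0 φ = φ 0 := by
  have : InStrip k [] := fun i => by simp
  simp [stripAvg, avg, this]

open Classical in
theorem stripAvg_ite (k n : ℕ) :
    stripAvg k n (fun y => if y = k then 1 else 0) = pr n (fun w => IsBridge w ∧ ht w = k) := by
  rw [pr_congr fun w _ => isBridge_and_ht_eq]
  refine avg_congr fun w _ => ?_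
  by_cases h : InStrip k w <;> simp [h]

/-- The function y + 1 is harmonic and vanishes at the lower killing point -1. Mass is lost only at
the top, where with probability 1/2 the walk would step to k + 1, of value k + 2. -/
theorem stripAvg_linear_succ (k n : ℕ) :
    stripAvg k (n + 1) (fun y => (y : ℝ) + 1) = stripAvg k n (fun y => (y : ℝ) + 1) -
      ((k : ℝ) + 2) / 2 * pr n (fun w => IsBridge w ∧ ht w = k) := by
  classical
  rw [← stripAvg_ite, ← stripAvg_mul_left, ← stripAvg_sub, stripAvg_succ]
  refine stripAvg_congr fun y h0 hk => ?_
  have h2 : y - 1 ≤ k := by omega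
  have h3 : 0 ≤ y + 1 := by omega
  simp only [h2, h3, and_true, true_and]
  rcases eq_or_ne y k with rfl | hne
  · rw [if_neg (by omega), if_pos rfl]
    split_ifs with h
    · push_cast; ring
    · have : k = 0 := by omega
      subst this
      simp
  · rw [if_pos (by omega), if_neg hne]
    split_ifs with h
    · push_cast; ring
    · have : y = 0 := by omega
      subst this
      norm_num

/-- This function vanishes at both killing points -1 and k + 1 and loses exactly 1 per step: it is
the expected exit time from the strip. -/
theorem stripAvg_quadratic_succ (k n : ℕ) :
    stripAvg k (n + 1) (fun y => ((y : ℝ) + 1) * (k + 1 - y)) =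
      stripAvg k n (fun y => ((y : ℝ) + 1) * (k + 1 - y)) - pr n (InStrip k) := by
  classical
  rw [← stripAvg_one, ← stripAvg_sub, stripAvg_succ]
  refine stripAvg_congr fun y h0 hk => ?_
  have h2 : y - 1 ≤ k := by omega
  have h3 : 0 ≤ y + 1 := by omega
  simp only [h2, h3, and_true, true_and]
  have e1 : (if y + 1 ≤ k then (((y + 1 : ℤ) : ℝ) + 1) * (k + 1 - ((y + 1 : ℤ) : ℝ)) else 0) =
      ((y : ℝ) + 2) * (k - y) := by
    split_ifs with h
    · push_cast; ring
    · have : y = k := by omega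
      subst this
      simp
  have e2 : (if 0 ≤ y - 1 then (((y - 1 : ℤ) : ℝ) + 1) * (k + 1 - ((y - 1 : ℤ) : ℝ)) else 0) =
      (y : ℝ) * (k + 2 - y) := by
    split_ifs with h
    · push_cast; ring
    · have : y = 0 := by omega
      subst this
      simp
  rw [e1, e2]
  ring

theorem sum_pr_isBridge_ht_eq (k n : ℕ) :
    ((k : ℝ) + 2) / 2 * ∑ l ∈ Finset.range n, pr l (fun w => IsBridge w ∧ ht w = k) =
      1 - stripAvg k n (fun y => (y : ℝ) + 1) := by
  induction n with
  | zero => simp [stripAvg_zero]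
  | succ n ih => rw [Finset.sum_range_succ, mul_add, ih, stripAvg_linear_succ]; ring

theorem sum_pr_inStrip (k n : ℕ) :
    ∑ l ∈ Finset.range n, pr l (InStrip k) =
      k + 1 - stripAvg k n (fun y => ((y : ℝ) + 1) * (k + 1 - y)) := by
  induction n with
  | zero => simp [stripAvg_zero]
  | succ n ih => rw [Finset.sum_range_succ, ih, stripAvg_quadratic_succ]; ring

theorem pr_inStrip_antitone (k : ℕ) {m n : ℕ} (h : m ≤ n) :
    pr n (InStrip k) ≤ pr m (InStrip k) := by
  classical
  obtain ⟨j, rfl⟩ := Nat.exists_eq_add_of_le h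
  unfold pr
  rw [avg_length_add]
  refine avg_mono fun u _ => ?_
  refine (avg_mono (g := fun _ => if InStrip k u then 1 else 0) fun v _ => ?_).trans_eq
    (avg_const _ _)
  by_cases h1 : InStrip k u
  · rw [if_pos h1]
    split_ifs <;> norm_num
  · rw [if_neg h1, if_neg fun h2 => h1 h2.of_append]

/-- The survival probability is nonincreasing in n, and its sum is at most the expected exit time k
+ 1 from height 0. -/
theorem mul_pr_inStrip_le (k n : ℕ) : n * pr n (InStrip k) ≤ k + 1 := by
  have h1 : n * pr n (InStrip k) ≤ ∑ l ∈ Finset.range n, pr l (InStrip k) := by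
    have := Finset.card_nsmul_le_sum (Finset.range n) (fun l => pr l (InStrip k))
      (pr n (InStrip k)) fun l hl => pr_inStrip_antitone k (Finset.mem_range.1 hl).le
    simpa using this
  have h2 : 0 ≤ stripAvg k n (fun y => ((y : ℝ) + 1) * (k + 1 - y)) := by
    have h3 : stripAvg k n (fun _ => 0) = 0 := by simp [stripAvg]
    rw [← h3]
    refine stripAvg_mono fun y h0 hk => ?_
    have h4 : (0 : ℝ) ≤ y := by exact_mod_cast h0
    have h5 : (y : ℝ) ≤ k := by exact_mod_cast hk
    exact mul_nonneg (by linarith) (by linarith)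
  linarith [sum_pr_inStrip k n]

theorem sum_pr_isBridge_ht_le (k n : ℕ) :
    ∑ l ∈ Finset.range n, pr l (fun w => IsBridge w ∧ ht w = k) ≤ 2 * ((k : ℝ) + 2)⁻¹ := by
  have h1 := sum_pr_isBridge_ht_eq k n
  have h2 : 0 ≤ stripAvg k n (fun y => (y : ℝ) + 1) := by
    have h3 : stripAvg k n (fun _ => 0) = 0 := by simp [stripAvg]
    rw [← h3]
    refine stripAvg_mono fun y h0 hk => ?_
    have h4 : (0 : ℝ) ≤ y := by exact_mod_cast h0
    linarith
  rw [← div_eq_mul_inv, le_div_iff₀ (by positivity)]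
  linarith

theorem le_sum_pr_isBridge_ht {n : ℕ} (hn : 0 < n) (k : ℕ) :
    2 * ((k : ℝ) + 2)⁻¹ - 2 * (k + 1) / n ≤
      ∑ l ∈ Finset.range n, pr l (fun w => IsBridge w ∧ ht w = k) := by
  have hn' : (0 : ℝ) < n := by exact_mod_cast hn
  have h1 := sum_pr_isBridge_ht_eq k n
  have h2 : stripAvg k n (fun y => (y : ℝ) + 1) ≤ (k + 1) * pr n (InStrip k) := by
    rw [← stripAvg_one, ← stripAvg_mul_left]
    refine stripAvg_mono fun y h0 hk => ?_
    have h5 : (y : ℝ) ≤ k := by exact_mod_cast hk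
    linarith
  have h3 : pr n (InStrip k) ≤ (k + 1) / n := by
    rw [le_div_iff₀ hn', mul_comm]
    exact mul_pr_inStrip_le k n
  -- The factor k + 1 is loosened to k + 2 so that division by (k + 2) / 2 is clean.
  have h4 : stripAvg k n (fun y => (y : ℝ) + 1) ≤ (k + 2) * ((k + 1) / n) :=
    h2.trans (mul_le_mul (by linarith) h3 (pr_nonneg _ _) (by positivity))
  have h5 : ((k : ℝ) + 2) / 2 * (2 * ((k : ℝ) + 2)⁻¹ - 2 * (k + 1) / n) =
      1 - (k + 2) * ((k + 1) / n) := by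
    field_simp
  have h6 : (0 : ℝ) < ((k : ℝ) + 2) / 2 := by positivity
  refine le_of_mul_le_mul_left ?_ h6
  linarith

theorem sum_inv_add_two (K : ℕ) :
    ∑ k ∈ Finset.range K, ((k : ℝ) + 2)⁻¹ = (harmonic (K + 1) : ℝ) - 1 := by
  rw [harmonic, Finset.sum_range_succ']
  push_cast
  simp only [inv_one, add_sub_cancel_right]
  refine Finset.sum_congr rfl fun k _ => ?_
  ring

theorem pr_isBridge_eq_sum (l K : ℕ) :
    pr l IsBridge = ∑ k ∈ Finset.range K, pr l (fun w => IsBridge w ∧ ht w = k) +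
      pr l (fun w => IsBridge w ∧ (K : ℤ) ≤ ht w) := by
  induction K with
  | zero =>
    rw [Finset.sum_range_zero, zero_add]
    refine pr_congr fun w _ => ⟨fun h => ⟨h, by simpa using h.1.ht_nonneg⟩, fun h => h.1⟩
  | succ K ih =>
    rw [ih, Finset.sum_range_succ, add_assoc]
    congr 1
    refine pr_or (fun w _ => ?_) (fun w _ h1 h2 => ?_)
    · push_cast
      constructor
      · rintro ⟨h, h1⟩
        rcases h1.eq_or_lt with h2 | h2
        · exact Or.inl ⟨h, h2.symm⟩
        · exact Or.inr ⟨h, h2⟩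
      · rintro (⟨h, h1⟩ | ⟨h, h1⟩)
        · exact ⟨h, h1.ge⟩
        · exact ⟨h, by omega⟩
    · have := h1.2
      have := h2.2
      push_cast at this
      omega

/-! ### Logarithmic growth of the number of bridges. -/

theorem log_sub_le_sum_pr_isBridge {n : ℕ} (hn : 0 < n) :
    Real.log n - 4 ≤ ∑ l ∈ Finset.range n, pr l IsBridge := by
  have hn' : (0 : ℝ) < n := by exact_mod_cast hn
  -- Up to height √n the errors 2 (k + 1) / n add up to at most 2, while the harmonic sum already
  -- gives 2 log √n = log n.
  set K := Nat.sqrt n with hK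
  have h1 : ∑ k ∈ Finset.range K, (2 * ((k : ℝ) + 2)⁻¹ - 2 * (k + 1) / n) ≤
      ∑ l ∈ Finset.range n, pr l IsBridge := by
    refine (Finset.sum_le_sum fun k _ => le_sum_pr_isBridge_ht hn k).trans ?_
    rw [Finset.sum_comm]
    refine Finset.sum_le_sum fun l _ => ?_
    rw [pr_isBridge_eq_sum l K]
    exact le_add_of_nonneg_right (pr_nonneg _ _)
  have h2 : ∑ k ∈ Finset.range K, 2 * ((k : ℝ) + 1) / n ≤ 2 := by
    have h3 : ∑ k ∈ Finset.range K, 2 * ((k : ℝ) + 1) / n ≤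
        ∑ k ∈ Finset.range K, 2 * (K : ℝ) / n := by
      refine Finset.sum_le_sum fun k hk => ?_
      have : ((k : ℝ) + 1) ≤ K := by exact_mod_cast Finset.mem_range.1 hk
      gcongr
    refine h3.trans ?_
    rw [Finset.sum_const, Finset.card_range, nsmul_eq_mul, ← mul_div_assoc, div_le_iff₀ hn']
    have : ((K : ℝ) * K) ≤ n := by exact_mod_cast Nat.sqrt_le n
    linarith
  rw [Finset.sum_sub_distrib, ← Finset.mul_sum, sum_inv_add_two] at h1
  have h4 := log_add_one_le_harmonic (K + 1)
  have h5 : Real.log n ≤ 2 * Real.log (((K + 1 : ℕ) : ℝ) + 1) := by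
    have h6 : (n : ℝ) ≤ (((K + 1 : ℕ) : ℝ) + 1) ^ 2 := by
      have h7 : (n : ℝ) ≤ ((K : ℝ) + 1) * (K + 1) := by
        exact_mod_cast (Nat.lt_succ_sqrt n).le
      push_cast
      nlinarith [(Nat.cast_nonneg K : (0 : ℝ) ≤ K)]
    have := Real.log_le_log hn' h6
    rwa [Real.log_pow, Nat.cast_ofNat] at this
  push_cast at h4 h5
  linarith

theorem avg_exp (t : ℝ) (n : ℕ) : avg n (fun w => Real.exp (t * ht w)) = Real.cosh t ^ n := by
  induction n with
  | zero => simp [avg]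
  | succ n ih =>
    have h : ∀ b w, Real.exp (t * ht (b :: w)) =
        Real.exp (t * letterStep b) * Real.exp (t * ht w) := fun b w => by
      rw [← Real.exp_add, ht_cons]
      push_cast
      ring_nf
    simp only [avg, h, avg_mul_left, ih, letterStep_true, letterStep_false]
    rw [pow_succ, Real.cosh_eq]
    push_cast
    ring_nf

theorem pr_le_ht_le {t : ℝ} (ht0 : 0 ≤ t) (l K : ℕ) :
    pr l (fun w => (K : ℤ) ≤ ht w) ≤ Real.exp (l * (t ^ 2 / 2) - t * K) := by
  have h1 : pr l (fun w => (K : ℤ) ≤ ht w) ≤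
      avg l (fun w => Real.exp (-(t * K)) * Real.exp (t * ht w)) := by
    refine avg_mono fun w _ => ?_
    split_ifs with h
    · have : (K : ℝ) ≤ ht w := by exact_mod_cast h
      rw [← Real.exp_add, Real.one_le_exp_iff]
      nlinarith
    · positivity
  refine h1.trans ?_
  rw [avg_mul_left, avg_exp, sub_eq_neg_add, Real.exp_add, Real.exp_nat_mul]
  gcongr
  exact Real.cosh_le_exp_half_sq t

theorem sum_pr_isBridge_le {n : ℕ} (hn : 0 < n) :
    ∑ l ∈ Finset.range n, pr l IsBridge ≤
      2 * Real.log (Real.sqrt n * Real.log n + 2) + 2 := by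
  have hn' : (0 : ℝ) < n := by exact_mod_cast hn
  have hlog : 0 ≤ Real.log n := Real.log_natCast_nonneg n
  have hs : 0 < Real.sqrt n := Real.sqrt_pos.2 hn'
  -- Higher endpoints are handled by the Chernoff bound with t = 1 / √n: each length contributes at
  -- most exp(1/2 - log n) ≤ 2 / n, hence at most 2 in total.
  set K := ⌈Real.sqrt n * Real.log n⌉₊ with hK
  have h1 : ∑ l ∈ Finset.range n, pr l (fun w => IsBridge w ∧ (K : ℤ) ≤ ht w) ≤ 2 := by
    have h2 : ∀ l ∈ Finset.range n, pr l (fun w => IsBridge w ∧ (K : ℤ) ≤ ht w) ≤ 2 / n := by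
      intro l hl
      refine (pr_mono (q := fun w => (K : ℤ) ≤ ht w) fun w _ h => h.2).trans ?_
      have hl' : (l : ℝ) ≤ n := by exact_mod_cast (Finset.mem_range.1 hl).le
      refine (pr_le_ht_le (inv_nonneg.2 hs.le) l K).trans ?_
      have h3 : (l : ℝ) * ((Real.sqrt n)⁻¹ ^ 2 / 2) - (Real.sqrt n)⁻¹ * K ≤
          1 / 2 - Real.log n := by
        have h4 : (l : ℝ) * ((Real.sqrt n)⁻¹ ^ 2 / 2) ≤ 1 / 2 := by
          rw [inv_pow, Real.sq_sqrt hn'.le]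
          rw [← mul_div_assoc, div_le_div_iff_of_pos_right (by norm_num), ← div_eq_mul_inv,
            div_le_one hn']
          exact hl'
        have h5 : Real.log n ≤ (Real.sqrt n)⁻¹ * K := by
          rw [inv_mul_eq_div, le_div_iff₀ hs, mul_comm]
          exact Nat.le_ceil _
        linarith
      refine (Real.exp_le_exp.2 h3).trans ?_
      rw [Real.exp_sub, Real.exp_log hn']
      gcongr
      have h6 : Real.exp (1 / 2) ^ 2 ≤ 2 ^ 2 := by
        rw [← Real.exp_nat_mul]
        have := Real.exp_one_lt_d9
        norm_num
        linarith
      exact le_of_sq_le_sq h6 (by norm_num)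
    refine (Finset.sum_le_sum h2).trans_eq ?_
    rw [Finset.sum_const, Finset.card_range, nsmul_eq_mul]
    field_simp
  have h7 : ∑ l ∈ Finset.range n, ∑ k ∈ Finset.range K, pr l (fun w => IsBridge w ∧ ht w = k) ≤
      2 * ((harmonic (K + 1) : ℝ) - 1) := by
    rw [Finset.sum_comm, ← sum_inv_add_two, Finset.mul_sum]
    exact Finset.sum_le_sum fun k _ => sum_pr_isBridge_ht_le k n
  have h8 := harmonic_le_one_add_log (K + 1)
  have h9 : Real.log ((K + 1 : ℕ) : ℝ) ≤ Real.log (Real.sqrt n * Real.log n + 2) := by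
    refine Real.log_le_log (by positivity) ?_
    have := Nat.ceil_lt_add_one (mul_nonneg hs.le hlog)
    push_cast
    linarith
  simp only [pr_isBridge_eq_sum _ K, Finset.sum_add_distrib]
  linarith

/-! ### Rarely visited edges are cut steps. -/

/-- The step number `t` of the path `s` goes up and separates the past from the future up to
time `n`. -/
def IsUpCut (s : ℕ → ℤ) (n t : ℕ) : Prop :=
  t < n ∧ (∀ i ≤ t, s i ≤ s t) ∧ s (t + 1) = s t + 1 ∧ ∀ i, t + 1 ≤ i → i ≤ n → s (t + 1) ≤ s i

/-- The step number `k - 1`, from `s (k - 1)` to `s k`, traverses the edge `⟨x, x + 1⟩`. -/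
def Crosses (s : ℕ → ℤ) (x : ℤ) (k : ℕ) : Prop :=
  (s k = x + 1 ∧ s (k - 1) = x) ∨ (s k = x ∧ s (k - 1) = x + 1)

theorem edgeVisits_eq_one_iff (s : ℕ → ℤ) (x : ℤ) (n : ℕ) :
    edgeVisits s x n = 1 ↔ ∃ t < n, Crosses s x (t + 1) ∧
      ∀ k, 0 < k → k ≤ n → Crosses s x k → k = t + 1 := by
  classical
  have h : edgeVisits s x n = ((Finset.Ioc 0 n).filter (Crosses s x)).card := by
    unfold edgeVisits upcrossings downcrossings
    rw [← Finset.card_union_of_disjoint, ← Finset.filter_or]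
    · congr 1
      refine Finset.filter_congr fun k _ => ?_
      simp only [Crosses, add_sub_cancel_right]
    · rw [Finset.disjoint_filter]
      rintro k _ ⟨h1, _⟩ ⟨h2, _⟩
      omega
  rw [h, Finset.card_eq_one]
  constructor
  · rintro ⟨k, hk⟩
    have h1 : k ∈ (Finset.Ioc 0 n).filter (Crosses s x) := by simp [hk]
    simp only [Finset.mem_filter, Finset.mem_Ioc] at h1
    obtain ⟨t, rfl⟩ := Nat.exists_eq_add_one_of_ne_zero h1.1.1.ne'
    refine ⟨t, by omega, h1.2, fun j hj hjn hc => ?_⟩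
    have h2 : j ∈ (Finset.Ioc 0 n).filter (Crosses s x) := by simp [hj, hjn, hc]
    rw [hk] at h2
    simpa using h2
  · rintro ⟨t, ht, hc, hu⟩
    refine ⟨t + 1, ?_⟩
    ext k
    simp only [Finset.mem_filter, Finset.mem_Ioc, Finset.mem_singleton]
    refine ⟨fun h => hu k h.1.1 h.1.2 h.2, ?_⟩
    rintro rfl
    exact ⟨⟨by omega, by omega⟩, hc⟩

/-- A discrete intermediate value property: unit steps can change sides of an edge only by crossing
it. -/
theorem le_iff_of_not_crosses {s : ℕ → ℤ} {n : ℕ}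
    (hs : ∀ k < n, s (k + 1) = s k + 1 ∨ s (k + 1) = s k - 1) {x : ℤ} {i j : ℕ} (hij : i ≤ j)
    (hj : j ≤ n) (h : ∀ k, i < k → k ≤ j → ¬ Crosses s x k) : s i ≤ x ↔ s j ≤ x := by
  induction j, hij using Nat.le_induction with
  | base => rfl
  | succ j hij ih =>
    rw [ih (by omega) fun k hk hkj => h k hk (by omega)]
    have h1 := h (j + 1) (by omega) le_rfl
    have h2 := hs j (by omega)
    simp only [Crosses, Nat.add_sub_cancel] at h1
    omega

theorem mem_rareEdges_iff {s : ℕ → ℤ} {n : ℕ}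
    (hs : ∀ k < n, s (k + 1) = s k + 1 ∨ s (k + 1) = s k - 1) (x : ℤ) :
    x ∈ rareEdges s n ↔ (∃ t, IsUpCut s n t ∧ s t = x) ∨
      -- A downward crossing of the edge starts at s t = x + 1, hence the shift by one after
      -- reflection.
      ∃ t, IsUpCut (fun k => -s k) n t ∧ -s t = -x - 1 := by
  have hrare : x ∈ rareEdges s n ↔ edgeVisits s x n = 1 := Iff.rfl
  rw [hrare, edgeVisits_eq_one_iff]
  constructor
  · rintro ⟨t, ht, hc, hu⟩
    have hleft : ∀ i ≤ t, (s i ≤ x ↔ s t ≤ x) := fun i hi =>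
      le_iff_of_not_crosses hs hi ht.le fun k hk hkt hck => by
        have := hu k (by omega) (by omega) hck
        omega
    have hright : ∀ i, t + 1 ≤ i → i ≤ n → (s (t + 1) ≤ x ↔ s i ≤ x) := fun i hi hin =>
      le_iff_of_not_crosses hs hi hin fun k hk hkt hck => by
        have := hu k (by omega) (by omega) hck
        omega
    simp only [Crosses, Nat.add_sub_cancel] at hc
    rcases hc with ⟨h1, h2⟩ | ⟨h1, h2⟩
    · refine Or.inl ⟨t, ⟨ht, fun i hi => ?_, by omega, fun i hi hin => ?_⟩, h2⟩
      · have := hleft i hi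
        omega
      · have := hright i hi hin
        omega
    · refine Or.inr ⟨t, ⟨ht, fun i hi => ?_, ?_, fun i hi hin => ?_⟩, by omega⟩
      · have := hleft i hi
        show -s i ≤ -s t
        omega
      · show -s (t + 1) = -s t + 1
        omega
      · have := hright i hi hin
        show -s (t + 1) ≤ -s i
        omega
  · rintro (⟨t, ⟨ht, h1, h2, h3⟩, rfl⟩ | ⟨t, ⟨ht, h1, h2, h3⟩, h4⟩)
    · refine ⟨t, ht, Or.inl ⟨h2, rfl⟩, fun k hk hkn hc => ?_⟩
      rcases lt_trichotomy k (t + 1) with h | h | h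
      · have := h1 k (by omega)
        have := h1 (k - 1) (by omega)
        unfold Crosses at hc
        omega
      · exact h
      · have := h3 k (by omega) hkn
        have := h3 (k - 1) (by omega) (by omega)
        unfold Crosses at hc
        omega
    · simp only at h1 h2 h3
      refine ⟨t, ht, Or.inr ⟨by omega, by rw [Nat.add_sub_cancel]; omega⟩,
        fun k hk hkn hc => ?_⟩
      rcases lt_trichotomy k (t + 1) with h | h | h
      · have := h1 k (by omega)
        have := h1 (k - 1) (by omega)
        unfold Crosses at hc
        omega
      · exact h
      · have := h3 k (by omega) hkn
        have := h3 (k - 1) (by omega) (by omega)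
        unfold Crosses at hc
        omega

theorem isCut_iff_isUpCut {w : List Bool} {s : ℕ → ℤ}
    (hs : ∀ k ≤ w.length, s k = ht (w.take k)) (t : ℕ) :
    IsCut w t ↔ IsUpCut s w.length t := by
  have hsub : ∀ i j, i ≤ j → j ≤ w.length → ht ((w.take j).drop i) = s j - s i := by
    intro i j hij hj
    have h1 : ht ((w.take j).take i) + ht ((w.take j).drop i) = ht (w.take j) := by
      rw [← ht_append, List.take_append_drop]
    rw [List.take_take, min_eq_left hij] at h1
    rw [hs i (hij.trans hj), hs j hj]
    omega
  by_cases htl : t < w.length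
  · have e1 : w[t]? = some true ↔ s (t + 1) = s t + 1 := by
      have h1 := hsub t (t + 1) (by omega) (by omega)
      have h2 : (w.take (t + 1)).drop t = [w[t]] := by
        rw [List.take_succ_eq_append_getElem htl, List.drop_append,
          List.drop_of_length_le (by simp)]
        simp [htl.le]
      rw [h2] at h1
      rw [List.getElem?_eq_getElem htl]
      cases hb : w[t]
      · simp [hb] at h1 ⊢
        omega
      · simp [hb] at h1 ⊢
        omega
    have e2 : EndsAtMax (w.take t) ↔ ∀ i ≤ t, s i ≤ s t := by
      constructor
      · intro h i hi
        have := h i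
        rw [hsub i t hi htl.le] at this
        omega
      · intro h i
        rcases le_total i t with hi | hi
        · rw [hsub i t hi htl.le]
          have := h i hi
          omega
        · rw [List.drop_of_length_le (by simp; omega)]
          simp
    have e3 : StaysNonneg (w.drop (t + 1)) ↔
        ∀ i, t + 1 ≤ i → i ≤ w.length → s (t + 1) ≤ s i := by
      have h0 : ∀ i, (w.drop (t + 1)).take i = (w.take (t + 1 + i)).drop (t + 1) := fun i => by
        rw [List.drop_take, Nat.add_sub_cancel_left]
      constructor
      · intro h i hi hin
        have := h (i - (t + 1))
        rw [h0, Nat.add_sub_cancel' hi, hsub _ _ hi hin] at this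
        omega
      · intro h i
        rw [h0]
        rcases le_total (t + 1 + i) w.length with hi | hi
        · rw [hsub _ _ (by omega) hi]
          have := h _ (by omega) hi
          omega
        · have := hsub (t + 1) w.length (by omega) le_rfl
          rw [List.take_length] at this
          rw [List.take_of_length_le hi, this]
          have := h w.length (by omega) le_rfl
          omega
    unfold IsCut IsUpCut
    rw [e1, e2, e3]
    tauto
  · exact ⟨fun h => absurd h.lt htl, fun h => absurd h.1 htl⟩

theorem IsUpCut.lt_of_lt {s : ℕ → ℤ} {n t t' : ℕ} (h : IsUpCut s n t) (h' : IsUpCut s n t')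
    (htt : t < t') : s t < s t' := by
  have := h.2.2.2 t' htt h'.1.le
  have := h.2.2.1
  omega

theorem IsUpCut.injOn (s : ℕ → ℤ) (n : ℕ) : Set.InjOn s {t | IsUpCut s n t} := by
  intro t ht t' ht' he
  rcases lt_trichotomy t t' with h | h | h
  · have := IsUpCut.lt_of_lt ht ht' h
    omega
  · exact h
  · have := IsUpCut.lt_of_lt ht' ht h
    omega

theorem numCuts_eq_ncard {w : List Bool} {s : ℕ → ℤ}
    (hs : ∀ k ≤ w.length, s k = ht (w.take k)) :
    numCuts w = (s '' {t | IsUpCut s w.length t}).ncard := by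
  classical
  rw [(IsUpCut.injOn s w.length).ncard_image, numCuts, ← Set.ncard_coe_finset]
  congr 1
  ext t
  simp only [Finset.coe_filter, Finset.mem_range, Set.mem_ofPred_eq, isCut_iff_isUpCut hs]
  exact ⟨fun h => h.2, fun h => ⟨h.1, h⟩⟩

theorem IsUpCut.pos {s : ℕ → ℤ} {n t : ℕ} (h : IsUpCut s n t) : s 0 < s n := by
  have h1 := h.2.1 0 (Nat.zero_le _)
  have h2 := h.2.2.2 n h.1 le_rfl
  have h3 := h.2.2.1
  omega

theorem steps_of_eq_ht {w : List Bool} {s : ℕ → ℤ} (hs : ∀ k ≤ w.length, s k = ht (w.take k)) :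
    ∀ k < w.length, s (k + 1) = s k + 1 ∨ s (k + 1) = s k - 1 := by
  intro k hk
  rw [hs (k + 1) hk, hs k hk.le, List.take_succ_eq_append_getElem hk, ht_append]
  cases w[k] <;> simp [sub_eq_add_neg]

/-- A cut forces the endpoint above the start, which cannot hold for both a path and its reflection.
-/
theorem numCuts_eq_zero_of_map_not {w : List Bool} (h : numCuts w ≠ 0) :
    numCuts (w.map not) = 0 := by
  by_contra h'
  have key : ∀ v : List Bool, numCuts v ≠ 0 → 0 < ht v := by
    intro v hv
    obtain ⟨t, ht'⟩ := numCuts_ne_zero_iff.1 hv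
    have := ((isCut_iff_isUpCut (s := fun k => ht (v.take k)) (fun _ _ => rfl) t).1 ht').pos
    simpa using this
  have h1 := key _ h
  have h2 := key _ h'
  rw [ht_map_not] at h2
  omega

theorem alpha_eq {w : List Bool} {s : ℕ → ℤ} (hs : ∀ k ≤ w.length, s k = ht (w.take k)) :
    alpha s w.length = numCuts w + numCuts (w.map not) := by
  have hs' : ∀ k ≤ (w.map not).length, (fun k => -s k) k = ht ((w.map not).take k) := by
    intro k hk
    rw [List.length_map] at hk
    rw [← List.map_take, ht_map_not, ← hs k hk]
  have h1 := numCuts_eq_ncard hs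
  have h2 := numCuts_eq_ncard hs'
  rw [List.length_map] at h2
  set A := s '' {t | IsUpCut s w.length t} with hA
  set D := (fun k => -s k) '' {t | IsUpCut (fun k => -s k) w.length t} with hD
  have hinj : Function.Injective (fun y : ℤ => -y - 1) := fun y z h => by
    simp only at h
    omega
  have h3 : rareEdges s w.length = A ∪ (fun y : ℤ => -y - 1) '' D := by
    ext x
    rw [mem_rareEdges_iff (steps_of_eq_ht hs)]
    simp only [hA, hD, Set.mem_union, Set.mem_image, Set.mem_ofPred_eq, exists_exists_and_eq_and]
    refine or_congr Iff.rfl (exists_congr fun t => and_congr Iff.rfl ?_)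
    omega
  have hfin : (rareEdges s w.length).Finite := rareEdges_finite s w.length
  rw [h3] at hfin
  rw [alpha, h3, Set.ncard_union_eq ?_ (hfin.subset Set.subset_union_left)
    (hfin.subset Set.subset_union_right), Set.ncard_image_of_injective _ hinj, h1, h2]
  rw [Set.disjoint_left]
  rintro x ⟨t, h4, _⟩ ⟨y, ⟨t', h5, _⟩, _⟩
  have h4' := IsUpCut.pos h4
  have h5' := IsUpCut.pos h5
  omega

theorem pr_map_not_or_numCuts (n i : ℕ) :
    pr n (fun w => i + 1 ≤ numCuts w + numCuts (w.map not)) =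
      2 * pr n (fun w => i + 1 ≤ numCuts w) := by
  have h1 : pr n (fun w => i + 1 ≤ numCuts w + numCuts (w.map not)) =
      pr n (fun w => i + 1 ≤ numCuts w) + pr n (fun w => i + 1 ≤ numCuts (w.map not)) := by
    refine pr_or (fun w _ => ?_) (fun w _ h => ?_)
    · by_cases h : numCuts w = 0
      · omega
      · rw [numCuts_eq_zero_of_map_not h]
        omega
    · rw [numCuts_eq_zero_of_map_not (by omega)]
      omega
  rw [h1, pr_map_not n (fun w => i + 1 ≤ numCuts w)]
  ring

/-! ### Transfer from words to the random walk. -/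

/-- The word of the first `n` steps of the path `s`. -/
def stepWord (s : ℕ → ℤ) (n : ℕ) : List Bool :=
  (List.range n).map fun i => decide (s (i + 1) - s i = 1)

@[simp] theorem length_stepWord (s : ℕ → ℤ) (n : ℕ) : (stepWord s n).length = n := by
  simp [stepWord]

theorem stepWord_succ (s : ℕ → ℤ) (n : ℕ) :
    stepWord s (n + 1) = stepWord s n ++ [decide (s (n + 1) - s n = 1)] := by
  simp [stepWord, List.range_succ]

theorem eq_ht_take_stepWord {s : ℕ → ℤ} (h0 : s 0 = 0)
    (hs : ∀ k, s (k + 1) - s k = 1 ∨ s (k + 1) - s k = -1) (n k : ℕ) (hk : k ≤ n) :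
    s k = ht ((stepWord s n).take k) := by
  have h1 : (stepWord s n).take k = stepWord s k := by
    rw [stepWord, ← List.map_take, List.take_range, min_eq_left hk, stepWord]
  rw [h1]
  clear h1 hk
  induction k with
  | zero => simpa [stepWord] using h0
  | succ k ih =>
    rw [stepWord_succ, ht_append, ← ih]
    rcases hs k with h | h
    · simp [h]
      omega
    · simp [h]
      omega

variable {Ω : Type*} [MeasurableSpace Ω] {P : Measure Ω} {S : ℕ → Ω → ℤ}

theorem IsSimpleSymmetricRandomWalk.measurable_step
    (hS : IsSimpleSymmetricRandomWalk P S) (n : ℕ) :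
    Measurable (fun ω => S (n + 1) ω - S n ω) :=
  (hS.measurable _).sub (hS.measurable _)

theorem IsSimpleSymmetricRandomWalk.ae_steps [IsProbabilityMeasure P]
    (hS : IsSimpleSymmetricRandomWalk P S) :
    ∀ᵐ ω ∂P, ∀ k, S (k + 1) ω - S k ω = 1 ∨ S (k + 1) ω - S k ω = -1 := by
  rw [ae_all_iff]
  intro k
  have hm : ∀ c : ℤ, MeasurableSet {ω | S (k + 1) ω - S k ω = c} := fun c =>
    hS.measurable_step k (measurableSet_singleton c)
  have h1 : P ({ω | S (k + 1) ω - S k ω = 1} ∪ {ω | S (k + 1) ω - S k ω = -1}) = 1 := by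
    rw [measure_union _ (hm _), hS.prob_up, hS.prob_down, ENNReal.add_halves]
    rw [Set.disjoint_left]
    intro ω h1 h2
    simp only [Set.mem_ofPred_eq] at h1 h2
    omega
  exact (prob_compl_eq_zero_iff ((hm _).union (hm _))).2 h1

theorem IsSimpleSymmetricRandomWalk.real_stepWord_eq [IsProbabilityMeasure P]
    (hS : IsSimpleSymmetricRandomWalk P S) {m : ℕ} {u : List Bool} (hu : u.length = m) :
    P.real {ω | stepWord (fun k => S k ω) m = u} = (1 / 2) ^ m := by
  -- The letter `false` records that the increment is not 1, rather than that it is -1, so the event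
  -- below is exactly an intersection of increment events and not merely almost surely.
  let A : ℕ → Set ℤ := fun i => if u[i]? = some true then {1} else {1}ᶜ
  have h1 : {ω | stepWord (fun k => S k ω) m = u} =
      ⋂ i ∈ Finset.range m, (fun ω => S (i + 1) ω - S i ω) ⁻¹' A i := by
    ext ω
    simp only [Set.mem_ofPred_eq, Set.mem_iInter, Finset.mem_range, Set.mem_preimage]
    constructor
    · rintro rfl i hi
      have h2 : (stepWord (fun k => S k ω) m)[i]? = some (decide (S (i + 1) ω - S i ω = 1)) := by
        simp [stepWord, List.getElem?_range hi]
      simp only [A, h2]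
      by_cases h3 : S (i + 1) ω - S i ω = 1 <;> simp [h3]
    · intro h
      refine List.ext_getElem (by simp [hu]) fun i hi hi' => ?_
      have h2 := h i (hu ▸ hi')
      simp only [A, List.getElem?_eq_getElem hi'] at h2
      simp only [stepWord, List.getElem_map, List.getElem_range]
      cases hb : u[i] <;> simpa [hb] using h2
  have h2 : ∀ i, P ((fun ω => S (i + 1) ω - S i ω) ⁻¹' A i) = 1 / 2 := by
    intro i
    have h3 : P ((fun ω => S (i + 1) ω - S i ω) ⁻¹' {1}) = 1 / 2 := hS.prob_up i
    simp only [A]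
    split_ifs
    · exact h3
    · rw [Set.preimage_compl, prob_compl_eq_one_sub
        (hS.measurable_step i (measurableSet_singleton _)), h3, one_div,
        ENNReal.one_sub_inv_two]
  rw [Measure.real, h1, hS.indep.measure_inter_preimage_eq_mul (Finset.range m)
    fun i _ => (Set.to_countable _).measurableSet]
  simp [h2]

theorem IsSimpleSymmetricRandomWalk.real_stepWord [IsProbabilityMeasure P]
    (hS : IsSimpleSymmetricRandomWalk P S) (n : ℕ) (p : List Bool → Prop) :
    P.real {ω | p (stepWord (fun k => S k ω) n)} = pr n p := by
  classical
  -- Induction on the number j of letters still free after a prescribed prefix; one step splits on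
  -- the next increment, matching the recursion of `avg`.
  suffices H : ∀ j m (u : List Bool), u.length = m → m + j = n →
      P.real {ω | stepWord (fun k => S k ω) m = u ∧ p (stepWord (fun k => S k ω) n)} =
        (1 / 2) ^ m * pr j (fun v => p (u ++ v)) by
    have h := H n 0 [] rfl (Nat.zero_add n)
    simpa [stepWord] using h
  intro j
  induction j with
  | zero =>
    rintro m u hu rfl
    have h1 : pr 0 (fun v => p (u ++ v)) = if p u then 1 else 0 := by simp [pr, avg]
    rw [h1]
    by_cases hp : p u
    · rw [if_pos hp, mul_one, ← hS.real_stepWord_eq hu]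
      congr 1
      ext ω
      exact ⟨fun h => h.1, fun h => ⟨h, by rw [add_zero, h]; exact hp⟩⟩
    · rw [if_neg hp, mul_zero]
      have : {ω | stepWord (fun k => S k ω) m = u ∧ p (stepWord (fun k => S k ω) (m + 0))} = ∅ := by
        ext ω
        simp only [Set.mem_ofPred_eq, Set.mem_empty_iff_false, iff_false, not_and]
        intro h
        rw [add_zero, h]
        exact hp
      rw [this, measureReal_empty]
  | succ j ih =>
    intro m u hu hn
    have h1 : ∀ b : Bool, P.real {ω | stepWord (fun k => S k ω) (m + 1) = u ++ [b] ∧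
        p (stepWord (fun k => S k ω) n)} =
          (1 / 2) ^ (m + 1) * pr j (fun v => p (u ++ b :: v)) := fun b => by
      rw [ih (m + 1) (u ++ [b]) (by simp [hu]) (by omega)]
      simp
    have h2 : pr (j + 1) (fun v => p (u ++ v)) =
        (pr j (fun v => p (u ++ true :: v)) + pr j (fun v => p (u ++ false :: v))) / 2 := rfl
    have h3 := measureReal_inter_add_sdiff (μ := P)
      (s := {ω | stepWord (fun k => S k ω) m = u ∧ p (stepWord (fun k => S k ω) n)})
      (hS.measurable_step m (measurableSet_singleton 1))
    have h4 : {ω | stepWord (fun k => S k ω) m = u ∧ p (stepWord (fun k => S k ω) n)} ∩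
        (fun ω => S (m + 1) ω - S m ω) ⁻¹' {1} =
        {ω | stepWord (fun k => S k ω) (m + 1) = u ++ [true] ∧
          p (stepWord (fun k => S k ω) n)} := by
      ext ω
      simp only [Set.mem_inter_iff, Set.mem_ofPred_eq, Set.mem_preimage, Set.mem_singleton_iff,
        stepWord_succ, List.append_singleton_inj, decide_eq_true_eq]
      tauto
    have h5 : {ω | stepWord (fun k => S k ω) m = u ∧ p (stepWord (fun k => S k ω) n)} \
        (fun ω => S (m + 1) ω - S m ω) ⁻¹' {1} =
        {ω | stepWord (fun k => S k ω) (m + 1) = u ++ [false] ∧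
          p (stepWord (fun k => S k ω) n)} := by
      ext ω
      simp only [Set.mem_sdiff, Set.mem_ofPred_eq, Set.mem_preimage, Set.mem_singleton_iff,
        stepWord_succ, List.append_singleton_inj, decide_eq_false_iff_not]
      tauto
    rw [h4, h5, h1, h1] at h3
    rw [← h3, h2]
    ring

theorem IsSimpleSymmetricRandomWalk.real_alpha_ge [IsProbabilityMeasure P]
    (hS : IsSimpleSymmetricRandomWalk P S) (n i : ℕ) :
    P.real {ω | i + 1 ≤ alpha (fun k => S k ω) n} = 2 * pr n (fun w => i + 1 ≤ numCuts w) := by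
  rw [← pr_map_not_or_numCuts, ← hS.real_stepWord]
  refine measureReal_congr ?_
  filter_upwards [hS.start, hS.ae_steps] with ω h0 hs
  refine propext ?_
  have h1 := alpha_eq (w := stepWord (fun k => S k ω) n) (s := fun k => S k ω)
    (fun k hk => eq_ht_take_stepWord (s := fun k => S k ω) h0 hs n k (by simpa using hk))
  rw [length_stepWord] at h1
  show i + 1 ≤ alpha (fun k => S k ω) n ↔ _
  rw [h1]
  rfl

/-! ### Asymptotics of the block weights and conclusion. -/

open Filter Topology

theorem psum_bridgeSeries_le_log {n : ℕ} (hn : 0 < n) :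
    psum n bridgeSeries ≤ Real.log n / 2 + Real.log (Real.log n + 2) + 2 := by
  have hn' : (1 : ℝ) ≤ n := by exact_mod_cast hn
  have hlog : 0 ≤ Real.log n := Real.log_natCast_nonneg n
  have hs : 1 ≤ Real.sqrt n := Real.one_le_sqrt.2 hn'
  have h1 := sum_pr_isBridge_le hn
  have h2 : Real.log (Real.sqrt n * Real.log n + 2) ≤
      Real.log n / 2 + Real.log (Real.log n + 2) := by
    rw [← Real.log_sqrt (by linarith), ← Real.log_mul (by linarith) (by linarith)]
    refine Real.log_le_log (by positivity) ?_
    nlinarith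
  rw [psum_bridgeSeries]
  linarith

/-- With U the partial sum of the renewal series, the renewal inequality gives f ≥ (U - 1) / U, and
U / (U - 1) = 1 + 1 / (U - 1) ≤ exp(1 / (U - 1)). -/
theorem exp_neg_inv_le_psum_irrSeries {n : ℕ} (h : 1 < psum n bridgeSeries) :
    Real.exp (-(psum n bridgeSeries - 1)⁻¹) ≤ psum n irrSeries := by
  have h1 := psum_bridgeSeries_le n
  set u := psum n bridgeSeries
  set f := psum n irrSeries
  have hu : 0 < u - 1 := by linarith
  have h2 : (u - 1) / u ≤ f := by
    rw [div_le_iff₀ (by linarith)]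
    linarith
  refine le_trans ?_ h2
  rw [Real.exp_neg, inv_le_comm₀ (Real.exp_pos _) (by apply div_pos <;> linarith), inv_div]
  have h3 := Real.add_one_le_exp (u - 1)⁻¹
  have h4 : u / (u - 1) = (u - 1)⁻¹ + 1 := by
    field_simp
    ring
  rwa [h4]

theorem tendsto_log_linear_div {b : ℝ} (hb : 0 < b) (d : ℝ) :
    Tendsto (fun L : ℝ => Real.log (b * L + d) / L) atTop (𝓝 0) := by
  have h1 : Tendsto (fun L : ℝ => b * L + d) atTop atTop :=
    tendsto_atTop_add_const_right _ _ (tendsto_id.const_mul_atTop hb)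
  refine ((Real.tendsto_pow_log_div_mul_add_atTop b⁻¹ (-(d / b)) 1
    (inv_ne_zero hb.ne')).comp h1).congr fun L => ?_
  have h2 : b⁻¹ * (b * L + d) + -(d / b) = L := by
    field_simp
    ring
  simp only [Function.comp_apply, pow_one, h2]

theorem tendsto_log_natCast_atTop : Tendsto (fun n : ℕ => Real.log n) atTop atTop :=
  Real.tendsto_log_atTop.comp tendsto_natCast_atTop_atTop

/-- The geometric sum of f is at most W < K, which excludes f ≥ 1. As it is also at least K f^K, one
gets f^K ≤ W / K, and 1 - f^K equals (1 - f) times the sum. -/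
theorem one_sub_psum_irrSeries_ge {n K : ℕ} {W : ℝ} (hK : 0 < K)
    (hW : psum (K * n) bridgeSeries ≤ W) (hWK : W < K) :
    psum n irrSeries < 1 ∧ 1 - W / K ≤ (1 - psum n irrSeries) * W := by
  have hK' : (0 : ℝ) < K := by exact_mod_cast hK
  have h1 := (geom_sum_psum_irrSeries_le n K).trans hW
  have hf0 : 0 ≤ psum n irrSeries := coeffNonneg_irrSeries.psum_nonneg n
  set f := psum n irrSeries
  have hf1 : f < 1 := by
    by_contra! hf
    have h2 := Finset.card_nsmul_le_sum (Finset.range K) (fun k => f ^ k) 1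
      fun k _ => one_le_pow₀ hf
    simp only [Finset.card_range, nsmul_eq_mul, mul_one] at h2
    linarith
  refine ⟨hf1, ?_⟩
  have h2 := Finset.card_nsmul_le_sum (Finset.range K) (fun k => f ^ k) (f ^ K)
    fun k hk => pow_le_pow_of_le_one hf0 hf1.le (Finset.mem_range.1 hk).le
  simp only [Finset.card_range, nsmul_eq_mul] at h2
  have h3 : f ^ K ≤ W / K := by
    rw [le_div_iff₀ hK']
    linarith
  have h4 := geom_sum_mul_neg f K
  have h5 := mul_le_mul_of_nonneg_right h1 (by linarith : 0 ≤ 1 - f)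
  linarith

theorem eventually_le_one_sub_psum_irrSeries_mul_log {c : ℝ} (hc : c < 2) :
    ∀ᶠ n : ℕ in atTop, psum n irrSeries < 1 ∧ c ≤ (1 - psum n irrSeries) * Real.log n := by
  -- A bound for `psum (K * n) bridgeSeries` with L = log n and K = ⌈L²⌉: log K ≤ 2 log (L + 1) is
  -- halved, and log (K n) + 2 ≤ 3 L + 2. This K is large enough that W / K tends to 0, and small
  -- enough to leave the leading term L / 2 unchanged.
  let W : ℝ → ℝ := fun L => L / 2 + Real.log (1 * L + 1) + Real.log (3 * L + 2) + 2
  have hWL : Tendsto (fun L => W L / L) atTop (𝓝 (1 / 2)) := by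
    have h := (((tendsto_log_linear_div one_pos 1).add
      (tendsto_log_linear_div three_pos 2)).add
      (tendsto_const_nhds (x := (2 : ℝ)).div_atTop tendsto_id)).const_add (1 / 2)
    simp only [add_zero] at h
    refine h.congr' ?_
    filter_upwards [eventually_gt_atTop 0] with L hL
    simp only [W, id]
    field_simp
    ring
  have hWLL : Tendsto (fun L => W L / L ^ 2) atTop (𝓝 0) := by
    refine (hWL.div_atTop tendsto_id).congr fun L => ?_
    simp only [id]
    rw [div_div, pow_two]
  have hlim : Tendsto (fun L => (1 - W L / L ^ 2) / (W L / L)) atTop (𝓝 2) := by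
    have h := (hWLL.const_sub 1).div hWL (by norm_num)
    norm_num at h
    exact h
  have hev : ∀ᶠ L : ℝ in atTop, c ≤ (1 - W L / L ^ 2) / (W L / L) ∧ W L / L ^ 2 < 1 ∧ 0 < L :=
    ((hlim.eventually_const_le hc).and
      ((hWLL.eventually_lt_const one_pos).and (eventually_gt_atTop 0)))
  filter_upwards [tendsto_log_natCast_atTop.eventually hev, eventually_gt_atTop 0]
    with n ⟨h1, h2, h3⟩ hn
  set L := Real.log n with hL
  set K := ⌈L ^ 2⌉₊ with hK
  have hKL : L ^ 2 ≤ K := Nat.le_ceil _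
  have hLL : 0 < L ^ 2 := by positivity
  have hKpos : 0 < K := Nat.ceil_pos.2 hLL
  have hKR : (0 : ℝ) < K := by exact_mod_cast hKpos
  have hKu : (K : ℝ) ≤ (L + 1) ^ 2 := by
    have := (Nat.ceil_lt_add_one hLL.le).le
    nlinarith
  have hnR : (0 : ℝ) < n := by exact_mod_cast hn
  have hlogK : Real.log K ≤ 2 * Real.log (L + 1) := by
    have := Real.log_le_log hKR hKu
    rwa [Real.log_pow, Nat.cast_ofNat] at this
  have hlog1 : Real.log (L + 1) ≤ L := by
    have := Real.log_le_sub_one_of_pos (by linarith : 0 < L + 1)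
    linarith
  have hlogK0 : 0 ≤ Real.log K := Real.log_natCast_nonneg K
  have hu : psum (K * n) bridgeSeries ≤ W L := by
    refine (psum_bridgeSeries_le_log (Nat.mul_pos hKpos hn)).trans ?_
    rw [Nat.cast_mul, Real.log_mul hKR.ne' hnR.ne', ← hL]
    have h5 : Real.log (Real.log K + L + 2) ≤ Real.log (3 * L + 2) :=
      Real.log_le_log (by linarith) (by linarith)
    simp only [W, one_mul]
    linarith
  have hWpos : 0 < W L := by
    have h6 : 0 ≤ Real.log (1 * L + 1) := Real.log_nonneg (by linarith)
    have h7 : 0 ≤ Real.log (3 * L + 2) := Real.log_nonneg (by linarith)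
    simp only [W]
    linarith
  have hWL2 : W L < L ^ 2 := by rwa [div_lt_one hLL] at h2
  obtain ⟨h8, h9⟩ := one_sub_psum_irrSeries_ge hKpos hu (by linarith)
  refine ⟨h8, h1.trans ?_⟩
  rw [div_le_iff₀ (by positivity)]
  have h10 : W L / K ≤ W L / L ^ 2 := by gcongr
  have h11 : (1 - psum n irrSeries) * L * (W L / L) = (1 - psum n irrSeries) * W L := by
    field_simp
  rw [h11]
  linarith

theorem tendsto_natFloor_mul_sq_div {a : ℝ} (ha : 0 < a) :
    Tendsto (fun L : ℝ => (⌊a * L ^ 2⌋₊ : ℝ) / L ^ 2) atTop (𝓝 a) := by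
  have h1 : Tendsto (fun L : ℝ => a * L ^ 2) atTop atTop :=
    (tendsto_pow_atTop two_ne_zero).const_mul_atTop ha
  have h2 := ((tendsto_nat_floor_div_atTop (R := ℝ)).comp h1).const_mul a
  rw [mul_one] at h2
  refine h2.congr' ?_
  filter_upwards [eventually_gt_atTop 0] with L hL
  simp only [Function.comp_apply]
  field_simp

theorem natCast_rpow_eq_exp {n : ℕ} (hn : 0 < n) (x : ℝ) :
    (n : ℝ) ^ x = Real.exp (Real.log n * x) :=
  Real.rpow_def_of_pos (by exact_mod_cast hn) x

theorem eventually_pr_numCuts_lt {a ε : ℝ} (ha : 0 < a) (hε : 0 < ε) :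
    ∀ᶠ n : ℕ in atTop, 2 * pr n (fun w => ⌊a * Real.log n ^ 2⌋₊ + 1 ≤ numCuts w) <
      (n : ℝ) ^ (-2 * a + ε) := by
  -- Chosen so that c a = 2 a - ε / 2; the other half of ε absorbs the factor 2 and the floor.
  set c : ℝ := 2 - ε / (2 * a) with hc
  have hc2 : c < 2 := by
    have : 0 < ε / (2 * a) := by positivity
    linarith
  have hca : c * a = 2 * a - ε / 2 := by
    rw [hc]
    field_simp
  have hlim : Tendsto (fun L : ℝ => Real.log 2 / L - c * ((⌊a * L ^ 2⌋₊ : ℝ) / L ^ 2)) atTop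
      (𝓝 (-2 * a + ε / 2)) := by
    have h := (tendsto_const_nhds (x := Real.log 2).div_atTop tendsto_id).sub
      ((tendsto_natFloor_mul_sq_div ha).const_mul c)
    have e : 0 - c * a = -2 * a + ε / 2 := by rw [hca]; ring
    rw [e] at h
    exact h
  have hev := (hlim.eventually_lt_const (by linarith : -2 * a + ε / 2 < -2 * a + ε)).and
    (eventually_gt_atTop 0)
  filter_upwards [tendsto_log_natCast_atTop.eventually hev,
    eventually_le_one_sub_psum_irrSeries_mul_log hc2, eventually_gt_atTop 0]
    with n ⟨h1, h2⟩ ⟨h3, h4⟩ hn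
  rw [natCast_rpow_eq_exp hn]
  set L := Real.log n with hL
  set i := ⌊a * L ^ 2⌋₊ with hi
  have h5 : pr n (fun w => i + 1 ≤ numCuts w) ≤ psum n irrSeries ^ i := by
    obtain ⟨m, rfl⟩ := Nat.exists_eq_add_one_of_ne_zero hn.ne'
    exact (pr_numCuts_ge_le m i).trans (pow_le_pow_left₀ (coeffNonneg_irrSeries.psum_nonneg m)
      (coeffNonneg_irrSeries.psum_mono (Nat.le_succ m)) i)
  have h6 : psum n irrSeries ≤ Real.exp (-(c / L)) := by
    have h7 : c / L ≤ 1 - psum n irrSeries := by rwa [div_le_iff₀ h2]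
    have := Real.add_one_le_exp (-(c / L))
    linarith
  have h8 : psum n irrSeries ^ i ≤ Real.exp (-(c / L)) ^ i :=
    pow_le_pow_left₀ (coeffNonneg_irrSeries.psum_nonneg n) h6 i
  rw [← Real.exp_nat_mul] at h8
  calc 2 * pr n (fun w => i + 1 ≤ numCuts w)
      ≤ Real.exp (Real.log 2) * Real.exp (i * -(c / L)) := by
        rw [Real.exp_log two_pos]
        linarith
    _ = Real.exp (L * (Real.log 2 / L - c * ((i : ℝ) / L ^ 2))) := by
        rw [← Real.exp_add]
        congr 1
        field_simp
        ring
    _ < _ := Real.exp_lt_exp.2 (mul_lt_mul_of_pos_left h1 h2)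

/-- The 5 is the 4 of `log_sub_le_sum_pr_isBridge` plus 1 for the floor, since ⌊x⌋ ≥ x / 2 and log 2
< 1. -/
theorem eventually_exp_le_psum_irrSeries {c : ℝ} (hc0 : 0 < c) :
    ∀ᶠ n : ℕ in atTop,
      Real.exp (-(2 / (c * Real.log n - 5))) ≤ psum ⌊(n : ℝ) ^ c⌋₊ irrSeries := by
  have hev : ∀ᶠ L : ℝ in atTop, 5 < c * L :=
    (tendsto_id.const_mul_atTop hc0).eventually_gt_atTop 5
  filter_upwards [tendsto_log_natCast_atTop.eventually hev, eventually_gt_atTop 0] with n h1 hn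
  have hnc : (n : ℝ) ^ c = Real.exp (c * Real.log n) := by
    rw [natCast_rpow_eq_exp hn, mul_comm]
  set x := (n : ℝ) ^ c with hx
  have hx6 : 6 ≤ x := by
    have := Real.add_one_le_exp (c * Real.log n)
    linarith
  have hfl : x / 2 ≤ ⌊x⌋₊ := by
    have := (Nat.lt_floor_add_one x).le
    linarith
  have hpos : 0 < ⌊x⌋₊ := Nat.floor_pos.2 (by linarith)
  have h2 := log_sub_le_sum_pr_isBridge hpos
  have h3 : c * Real.log n - 1 ≤ Real.log ⌊x⌋₊ := by
    have h4 := Real.log_le_log (by linarith) hfl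
    rw [Real.log_div (by linarith) two_ne_zero, hnc, Real.log_exp, ← hnc] at h4
    have := Real.log_two_lt_d9
    linarith
  have h5 : (c * Real.log n - 5) / 2 ≤ psum ⌊x⌋₊ bridgeSeries - 1 := by
    rw [psum_bridgeSeries]
    linarith
  have h6 : 0 < (c * Real.log n - 5) / 2 := by linarith
  refine le_trans ?_ (exp_neg_inv_le_psum_irrSeries (by linarith))
  rw [Real.exp_le_exp, neg_le_neg_iff, ← inv_div]
  exact inv_anti₀ h6 h5

theorem eventually_lt_pr_numCuts {a ε : ℝ} (ha : 0 < a) (hε : 0 < ε) :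
    ∀ᶠ n : ℕ in atTop, (n : ℝ) ^ (-2 * a - ε) <
      2 * pr n (fun w => ⌊a * Real.log n ^ 2⌋₊ + 1 ≤ numCuts w) := by
  -- Blocks of length up to n^c give the exponent -2 a / c, which this choice makes equal to -(2 a +
  -- ε / 2).
  set c : ℝ := 2 * a / (2 * a + ε / 2) with hc
  have hc0 : 0 < c := by positivity
  have hc1 : c < 1 := by
    rw [hc, div_lt_one (by positivity)]
    linarith
  have hac : a * (2 / c) = 2 * a + ε / 2 := by
    rw [hc]
    field_simp
  have hlim : Tendsto (fun L : ℝ => -(Real.log (4 * L + 2) / L) -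
      ((⌊a * L ^ 2⌋₊ : ℝ) / L ^ 2) * (2 / (c - 5 / L))) atTop (𝓝 (-(2 * a + ε / 2))) := by
    have h := ((tendsto_log_linear_div four_pos 2).neg).sub
      ((tendsto_natFloor_mul_sq_div ha).mul
        ((tendsto_const_nhds (x := (2 : ℝ))).div
          ((tendsto_const_nhds (x := (5 : ℝ)).div_atTop tendsto_id).const_sub c) (by simpa using hc0.ne')))
    have e : -0 - a * (2 / (c - 0)) = -(2 * a + ε / 2) := by rw [sub_zero, hac]; ring
    rw [e] at h
    exact h
  have hev := (hlim.eventually_const_lt (by linarith : -2 * a - ε < -(2 * a + ε / 2))).and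
    ((eventually_gt_atTop 0).and ((tendsto_id.const_mul_atTop hc0).eventually_gt_atTop 5))
  -- As c < 1, the i blocks of length at most n^c fit into a word; the + 1 is there because the
  -- series identity for length n = m + 1 reads the coefficient of X^m.
  have hpow : ∀ᶠ n : ℕ in atTop, ⌊a * Real.log n ^ 2⌋₊ * ⌊(n : ℝ) ^ c⌋₊ + 1 ≤ n := by
    have h1 : (fun x : ℝ => Real.log x ^ 2) =o[atTop] fun x => x ^ (1 - c) := by
      refine (isLittleO_log_rpow_rpow_atTop 2 (by linarith : 0 < 1 - c)).congr_left fun x => ?_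
      exact_mod_cast Real.rpow_natCast (Real.log x) 2
    have h2 := (h1.def (show (0 : ℝ) < (2 * a)⁻¹ by positivity)).natCast_atTop
    filter_upwards [h2, eventually_ge_atTop 2] with n h3 hn
    have hn2 : (2 : ℝ) ≤ n := by exact_mod_cast hn
    have hn0 : (0 : ℝ) < n := by linarith
    rw [Real.norm_of_nonneg (by positivity), Real.norm_of_nonneg (by positivity)] at h3
    have h4 : a * Real.log n ^ 2 * (n : ℝ) ^ c ≤ n / 2 := by
      have h5 : (n : ℝ) ^ (1 - c) * (n : ℝ) ^ c = n := by
        rw [← Real.rpow_add hn0]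
        simp
      calc a * Real.log n ^ 2 * (n : ℝ) ^ c
          ≤ a * ((2 * a)⁻¹ * (n : ℝ) ^ (1 - c)) * (n : ℝ) ^ c := by gcongr
        _ = (a * (2 * a)⁻¹) * ((n : ℝ) ^ (1 - c) * (n : ℝ) ^ c) := by ring
        _ = n / 2 := by
          rw [h5]
          field_simp
    have h6 : ((⌊a * Real.log n ^ 2⌋₊ * ⌊(n : ℝ) ^ c⌋₊ + 1 : ℕ) : ℝ) ≤ n := by
      push_cast
      have h7 : (⌊a * Real.log n ^ 2⌋₊ : ℝ) * ⌊(n : ℝ) ^ c⌋₊ ≤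
          a * Real.log n ^ 2 * (n : ℝ) ^ c :=
        mul_le_mul (Nat.floor_le (by positivity)) (Nat.floor_le (by positivity))
          (by positivity) (by positivity)
      linarith
    exact_mod_cast h6
  filter_upwards [tendsto_log_natCast_atTop.eventually hev, hpow,
    eventually_le_one_sub_psum_irrSeries_mul_log (show (3 / 2 : ℝ) < 2 by norm_num),
    eventually_exp_le_psum_irrSeries hc0, eventually_gt_atTop 0]
    with n ⟨h1, h2, h2'⟩ hpw ⟨h3, h4⟩ h5 hn
  rw [natCast_rpow_eq_exp hn]
  simp only [id] at h2'
  set L := Real.log n with hL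
  set i := ⌊a * L ^ 2⌋₊ with hi
  set j := ⌊(n : ℝ) ^ c⌋₊ with hj
  -- With 1 - f_n ≥ (3/2) / L, this makes f_n^r ≤ exp(-3) ≤ 1/4, so that half of the 1/2 in
  -- `le_mul_pr_numCuts_ge` survives; the price is a factor of order log n.
  set r := ⌈2 * L⌉₊ with hr
  have hrL : 2 * L ≤ r := Nat.le_ceil _
  have hrL' : (r : ℝ) ≤ 2 * L + 1 := (Nat.ceil_lt_add_one (by linarith)).le
  have hr0 : (0 : ℝ) < r := by linarith
  obtain ⟨m, hm⟩ := Nat.exists_eq_add_one_of_ne_zero hn.ne'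
  have hf0 : 0 ≤ psum n irrSeries := coeffNonneg_irrSeries.psum_nonneg n
  have h6 : psum m irrSeries ^ r ≤ 1 / 4 := by
    have h7 : psum m irrSeries ^ r ≤ psum n irrSeries ^ r :=
      pow_le_pow_left₀ (coeffNonneg_irrSeries.psum_nonneg m)
        (coeffNonneg_irrSeries.psum_mono (by omega)) r
    have h8 : psum n irrSeries ^ r ≤ Real.exp (-(1 - psum n irrSeries)) ^ r := by
      refine pow_le_pow_left₀ hf0 ?_ r
      have := Real.add_one_le_exp (-(1 - psum n irrSeries))
      linarith
    rw [← Real.exp_nat_mul] at h8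
    have h9 : (r : ℝ) * -(1 - psum n irrSeries) ≤ -3 := by
      have := mul_le_mul_of_nonneg_right hrL (by linarith : 0 ≤ 1 - psum n irrSeries)
      linarith
    have h10 : Real.exp (-3) ≤ 1 / 4 := by
      rw [Real.exp_neg, one_div]
      refine inv_anti₀ (by norm_num) ?_
      have := Real.add_one_le_exp (3 : ℝ)
      linarith
    exact h7.trans (h8.trans ((Real.exp_le_exp.2 h9).trans h10))
  have h11 : psum j irrSeries ^ i ≤ psum m (irrSeries ^ i) :=
    (pow_psum_le coeffNonneg_irrSeries j i).trans
      ((coeffNonneg_irrSeries.pow i).psum_mono (by omega))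
  have h12 : Real.exp (-(2 / (c * L - 5))) ^ i ≤ psum j irrSeries ^ i :=
    pow_le_pow_left₀ (Real.exp_pos _).le h5 i
  rw [← Real.exp_nat_mul] at h12
  have h13 := le_mul_pr_numCuts_ge m i r
  rw [← hm] at h13
  set p := pr n (fun w => i + 1 ≤ numCuts w) with hp
  have h14 : Real.exp (i * -(2 / (c * L - 5))) / 4 ≤ r * p := by
    refine le_trans ?_ h13
    rw [div_eq_mul_inv]
    exact mul_le_mul (h12.trans h11) (by linarith) (by norm_num)
      ((coeffNonneg_irrSeries.pow i).psum_nonneg m)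
  calc Real.exp (L * (-2 * a - ε))
      < Real.exp (L * (-(Real.log (4 * L + 2) / L) - ((i : ℝ) / L ^ 2) * (2 / (c - 5 / L)))) :=
        Real.exp_lt_exp.2 (mul_lt_mul_of_pos_left h1 h2)
    _ = Real.exp (i * -(2 / (c * L - 5))) / (4 * L + 2) := by
        have h15 : c * L - 5 = L * (c - 5 / L) := by field_simp
        have h16 : c - 5 / L ≠ 0 := by
          intro h
          rw [h, mul_zero] at h15
          linarith
        rw [← Real.exp_log (by linarith : 0 < 4 * L + 2), ← Real.exp_sub,
          Real.exp_log (by linarith : 0 < 4 * L + 2), h15]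
        congr 1
        field_simp
        ring
    _ ≤ 2 * p := by
        rw [div_le_iff₀ (by linarith)]
        have hp0 : 0 ≤ p := pr_nonneg _ _
        nlinarith

end RarelyVisited

theorem theorem2 (a ε : ℝ) (ha : 0 < a) (hε : 0 < ε) :
    ∃ N₀ : ℕ, ∀ (Ω : Type*) [MeasurableSpace Ω] (P : Measure Ω) [IsProbabilityMeasure P]
      (S : ℕ → Ω → ℤ), RarelyVisited.IsSimpleSymmetricRandomWalk P S →
      ∀ n : ℕ, N₀ < n →
        (n : ℝ) ^ (-2 * a - ε) <
            P.real {ω | a * Real.log n ^ 2 < (RarelyVisited.alpha (fun k => S k ω) n : ℝ)} ∧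
          P.real {ω | a * Real.log n ^ 2 < (RarelyVisited.alpha (fun k => S k ω) n : ℝ)} <
            (n : ℝ) ^ (-2 * a + ε) := by
  -- Both bounds concern uniform words only, so the threshold does not depend on the probability
  -- space or the walk.
  obtain ⟨N₀, hN⟩ := Filter.eventually_atTop.1 ((RarelyVisited.eventually_lt_pr_numCuts ha hε).and
    (RarelyVisited.eventually_pr_numCuts_lt ha hε))
  refine ⟨N₀, fun Ω _ P _ S hS n hn => ?_⟩
  have h : {ω | a * Real.log n ^ 2 < (RarelyVisited.alpha (fun k => S k ω) n : ℝ)} =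
      {ω | ⌊a * Real.log n ^ 2⌋₊ + 1 ≤ RarelyVisited.alpha (fun k => S k ω) n} := by
    ext ω
    have h0 : 0 ≤ a * Real.log n ^ 2 := by positivity
    exact (Nat.floor_lt h0).symm
  rw [h, hS.real_alpha_ge]
  exact hN n hn.le
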